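/- Let $1\le M\le N$, $L\ge 1$ be integers and $p>0$. Let $R\in\mathbb C^{M\times M}$ be positive definite with eigendecomposition $R=U\,\mathrm{diag}(\lambda_1,\dots,\lambda_M)\,U^{\mathsf H}$, $U=[u_1,\dots,u_M]$ unitary. In the sensing-centric (S-C) design the normalized precoder for pair $m$ is $u_m$, and the powers $s_1^\star,\dots,s_M^\star\ge 0$ are such that $P=U\,\mathrm{diag}(s_1^\star,\dots,s_M^\star)^{1/2}$ maximizes $\log_2\det(I_M+LP^{\mathsf H}RP)$ over all $P\in\mathbb C^{M\times M}$ with $\mathrm{tr}(PP^{\mathsf H})\le p$. Then $s_m^\star=\max\{0,\tfrac1\nu-\tfrac1{L\lambda_m}\}$ for some $\nu>0$, with $\sum_m s_m^\star=p$. For each pair $m=1,\dots,M$ of user terminals (UTs), let UT $m$ and UT $m'$ have path losses $\eta_m,\eta_{m'}>0$ and power coefficients $\alpha_m,\alpha_{m'}>0$, $\alpha_m+\alpha_{m'}=1$, and let their channels $H_m,H_{m'}$ be random $N\times M$ matrices, each with i.i.d. $\mathcal{CN}(0,1)$ entries. Let $v_m,v_{m'}$ be random vectors in $\mathbb C^N$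 which almost surely solve $H_m^{\mathsf H}v_m=u_m$ and $H_{m'}^{\mathsf H}v_{m'}=u_m$; they are otherwise arbitrary. Put $$\gamma_m=\frac{\alpha_m\eta_m^{-1}s_m^\star|v_m^{\mathsf H}H_mu_m|^2}{\|v_m\|^2},\qquad \gamma_{m'}=\frac{\alpha_{m'}\eta_{m'}^{-1}s_m^\star|v_{m'}^{\mathsf H}H_{m'}u_m|^2}{\alpha_m\eta_{m'}^{-1}s_m^\star|v_{m'}^{\mathsf H}H_{m'}u_m|^2+\|v_{m'}\|^2},$$ and define the ergodic rates $\mathcal R_m=\mathbb E\log_2(1+\gamma_m)$ and $\mathcal R_{m'}=\mathbb E\log_2(1+\gamma_{m'})$ and the sum ergodic rate $\mathcal R=\sum_{m=1}^M(\mathcal R_m+\mathcal R_{m'})$. (i) Almost surely $\|v_m\|^2\ge 1/\lambda_{\max}(H_mH_m^{\mathsf H})$ and $\|v_{m'}\|^2\ge 1/\lambda_{\max}(H_{m'}H_{m'}^{\mathsf H})$. The largest eigenvalue of the complex Wishart matrix $HH^{\mathsf H}$, where $H\in\mathbb C^{N\times M}$ has i.i.d. $\mathcal{CN}(0,1)$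 entries, has a probability density $f_\gamma$. All expectations above and integrals below exist and are finite, and $$\mathcal R_m\le\tilde{\mathcal R}_m:=\int_0^\infty\log_2\bigl(1+\alpha_m\eta_m^{-1}s_m^\star x\bigr)f_\gamma(x)\,dx,\qquad \mathcal R_{m'}\le\tilde{\mathcal R}_{m'}:=\int_0^\infty\log_2\Bigl(1+\frac{\alpha_{m'}\eta_{m'}^{-1}s_m^\star x}{\alpha_m\eta_{m'}^{-1}s_m^\star x+1}\Bigr)f_\gamma(x)\,dx ,$$ so that $\mathcal R\le\sum_{m=1}^M(\tilde{\mathcal R}_m+\tilde{\mathcal R}_{m'})$. (ii) If $N=M$, then $1/\|v_m\|^2$ and $1/\|v_{m'}\|^2$ are standard exponential random variables. With $\mathrm{Ei}(x)=\int_{-\infty}^x\frac{e^t}{t}\,dt$ for $x<0$, $E(a)=e^{1/a}\,\mathrm{Ei}(-1/a)$ for $a>0$ and $E(0)=0$ (its limit), $$\mathcal R_m=-\frac1{\ln 2}E\bigl(\alpha_m\eta_m^{-1}s_m^\star\bigr),\qquad \mathcal R_{m'}=-\frac1{\ln 2}E\bigl(\eta_{m'}^{-1}s_m^\star\bigr)+\frac1{\ln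 2}E\bigl(\alpha_m\eta_{m'}^{-1}s_m^\star\bigr),$$ and $\mathcal R=\sum_{m=1}^M(\mathcal R_m+\mathcal R_{m'})$ is the sum of these expressions. -/

import Mathlib

open MeasureTheory ProbabilityTheory
open scoped Matrix NNReal ComplexOrder

noncomputable section

namespace NomaIsac

/-- The standard circularly symmetric complex Gaussian law `CN(0,1)`: real and imaginary parts
are independent real Gaussians of mean `0` and variance `1/2`. -/
def stdComplexGaussian : Measure ℂ :=
  ((gaussianReal 0 (1 / 2)).prod (gaussianReal 0 (1 / 2))).map
    Complex.measurableEquivRealProd.symm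

/-- A random `N × M` matrix of i.i.d. Rayleigh fading gains: the entries are independent, each
with law `CN(0,1)`. -/
structure IsRayleighChannel {Ω : Type*} [MeasurableSpace Ω] {N M : ℕ}
    (H : Ω → Matrix (Fin N) (Fin M) ℂ) (P : Measure Ω) : Prop where
  law : ∀ i j, HasLaw (fun ω => H ω i j) stdComplexGaussian P
  indep : iIndepFun (fun (k : Fin N × Fin M) (ω : Ω) => H ω k.1 k.2) P

/-- The largest eigenvalue of the Hermitian matrix `H Hᴴ`. -/
def largestEig {N M : ℕ} (H : Matrix (Fin N) (Fin M) ℂ) : ℝ :=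
  ⨆ i, (Matrix.isHermitian_mul_conjTranspose_self H).eigenvalues i

/-- The law of (the entries of) an `N × M` matrix with i.i.d. `CN(0,1)` entries. -/
def gaussianMatrixLaw (N M : ℕ) : Measure (Fin N × Fin M → ℂ) :=
  Measure.pi fun _ => stdComplexGaussian

/-- The largest eigenvalue of the complex Wishart matrix `H Hᴴ`, as a random variable on the
space of entries of `H`. -/
def wishartMaxEig (N M : ℕ) (h : Fin N × Fin M → ℂ) : ℝ :=
  largestEig (Matrix.of fun i j => h (i, j))

/-- The probability density function `f_γ` of the largest eigenvalue of the complex Wishart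
matrix `H Hᴴ`, where `H` is `N × M` with i.i.d. `CN(0,1)` entries. -/
def wishartMaxEigPDF (N M : ℕ) (x : ℝ) : ℝ :=
  (pdf (wishartMaxEig N M) (gaussianMatrixLaw N M) volume x).toReal

/-- The quantity `log₂ det (I + L Pᴴ R P)` that the sensing-centric precoder maximizes. -/
def sensingObjective {M : ℕ} (R : Matrix (Fin M) (Fin M) ℂ) (L : ℕ)
    (P : Matrix (Fin M) (Fin M) ℂ) : ℝ :=
  Real.logb 2 (Matrix.det (1 + (L : ℂ) • (Pᴴ * R * P))).re

/-- The precoders that meet the power budget, `tr (P Pᴴ) ≤ p`. -/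
def feasiblePrecoders (M : ℕ) (p : ℝ) : Set (Matrix (Fin M) (Fin M) ℂ) :=
  {P | (Matrix.trace (P * Pᴴ)).re ≤ p}

/-- The precoder `W Ξ^{1/2}` with normalized precoding matrix `W` and powers `Ξ = diag s`. -/
def precoder {M : ℕ} (W : Matrix (Fin M) (Fin M) ℂ) (s : Fin M → ℝ) :
    Matrix (Fin M) (Fin M) ℂ :=
  W * Matrix.diagonal fun m => ((Real.sqrt (s m) : ℝ) : ℂ)

/-- The sensing-centric design: the normalized precoders are the columns of a unitary matrix `U`
from an eigendecomposition `R = U diag(lam) Uᴴ`, and the powers `s` are such that the precoder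
`U diag(s)^{1/2}` maximizes the sensing rate among all precoders within the power budget. -/
structure IsSCDesign {M : ℕ} (R : Matrix (Fin M) (Fin M) ℂ) (L : ℕ) (p : ℝ)
    (U : Matrix (Fin M) (Fin M) ℂ) (lam s : Fin M → ℝ) : Prop where
  unitary : U ∈ Matrix.unitaryGroup (Fin M) ℂ
  eigen : R = U * Matrix.diagonal (fun m => (lam m : ℂ)) * Uᴴ
  nonneg : ∀ m, 0 ≤ s m
  feasible : precoder U s ∈ feasiblePrecoders M p
  optimal : IsMaxOn (sensingObjective R L) (feasiblePrecoders M p) (precoder U s)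

/-- `v` is almost surely a solution of the signal alignment equation `Hᴴ v = u`. -/
def IsDetector {Ω : Type*} [MeasurableSpace Ω] {N M : ℕ} (P : Measure Ω)
    (H : Ω → Matrix (Fin N) (Fin M) ℂ) (u : Fin M → ℂ)
    (v : Ω → EuclideanSpace ℂ (Fin N)) : Prop :=
  AEMeasurable v P ∧ ∀ᵐ ω ∂P, (H ω)ᴴ *ᵥ (v ω).ofLp = u

/-- The squared modulus `|vᴴ H w|²`. -/
def gain {N M : ℕ} (H : Matrix (Fin N) (Fin M) ℂ) (w : Fin M → ℂ)
    (v : EuclideanSpace ℂ (Fin N)) : ℝ :=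
  ‖star v.ofLp ⬝ᵥ (H *ᵥ w)‖ ^ 2

/-- The SNR of the near terminal, which first removes the far terminal's message: `α` is its
power coefficient, `η` its path loss, `q` the power of the pair's stream, `w` its precoder. -/
def snrNear {N M : ℕ} (α η q : ℝ) (H : Matrix (Fin N) (Fin M) ℂ) (w : Fin M → ℂ)
    (v : EuclideanSpace ℂ (Fin N)) : ℝ :=
  α * η⁻¹ * q * gain H w v / ‖v‖ ^ 2

/-- The SINR of the far terminal: `α'` is its own power coefficient and `α` that of the near
terminal of the pair, `η'` is the path loss of the far terminal. -/
def sinrFar {N M : ℕ} (α α' η' q : ℝ) (H : Matrix (Fin N) (Fin M) ℂ) (w : Fin M → ℂ)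
    (v : EuclideanSpace ℂ (Fin N)) : ℝ :=
  α' * η'⁻¹ * q * gain H w v / (α * η'⁻¹ * q * gain H w v + ‖v‖ ^ 2)

/-- The ergodic rate `E[log₂ (1 + γ)]`. -/
def ergodicRate {Ω : Type*} [MeasurableSpace Ω] (P : Measure Ω) (γ : Ω → ℝ) : ℝ :=
  ∫ ω, Real.logb 2 (1 + γ ω) ∂P

/-- Integrand of the upper bound for the near terminal. -/
def nearIntegrand (N M : ℕ) (α η q x : ℝ) : ℝ :=
  Real.logb 2 (1 + α * η⁻¹ * q * x) * wishartMaxEigPDF N M x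

/-- Integrand of the upper bound for the far terminal. -/
def farIntegrand (N M : ℕ) (α α' η' q x : ℝ) : ℝ :=
  Real.logb 2 (1 + α' * η'⁻¹ * q * x / (α * η'⁻¹ * q * x + 1)) * wishartMaxEigPDF N M x

/-- The exponential integral `Ei x = ∫_{-∞}^x e^t / t dt` (used for `x < 0` only). -/
def Ei (x : ℝ) : ℝ := ∫ t in Set.Iic x, Real.exp t / t

/-- `exp (1/a) Ei (-1/a)` for `a > 0`, with its limit value `0` at `a = 0`
(a stream that receives no power). -/
def expEi (a : ℝ) : ℝ := if 0 < a then Real.exp (1 / a) * Ei (-(1 / a)) else 0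

end NomaIsac

end

noncomputable section

namespace NomaIsac

/-! ### The largest eigenvalue of `H Hᴴ`: variational description, scaling, measurability -/

section

variable {N M : ℕ}

/-! Since `Hᴴ v = u` with `‖u‖ = 1`, the gain `|vᴴ H u|²` equals 1 (`gain_eq_one`). Both rates thus
become increasing functions `φ` of the single variable `1/‖v‖²`, with at most linear growth and `φ 0
= 0`.

Upper bounds: the Rayleigh quotient gives `1 = ‖Hᴴ v‖² ≤ λ_max ‖v‖²`, hence `1/‖v‖² ≤ λ_max`; apply
`φ` and integrate. Everything is integrable because `λ_max` is at most the squared Frobenius norm.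
`λ_max` has a density because it is homogeneous of degree 2: almost every dilate of a nonzero matrix
avoids a given null set of eigenvalues, and Fubini concludes
(`measure_eq_zero_of_forall_ae_notMem`).

Exact rates for `N = M`: `H U` has the law of `H`, and `(H U)ᴴ v = e_m`. By Cramer's rule `1/‖v‖²`
is `|det|²` over the sum of the squared cofactors of column `m`. Given the other columns, the
determinant is a linear form in an independent Gaussian column with exactly these coefficients, so
the quotient is standard exponential (`map_invNormSq_gaussianMatrixLaw`). Integration by parts then
produces `Ei`.

Water-filling: comparison with precoders `U diag(t)^{1/2}` alone reduces optimality to maximizing a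
product of affine factors, settled by moving power between two streams
(`waterFilling_of_isMaxOn_prod`). -/

lemma dotProduct_star_self_eq_sum {ι : Type*} [Fintype ι] (x : ι → ℂ) :
    star x ⬝ᵥ x = ((∑ i, ‖x i‖ ^ 2 : ℝ) : ℂ) := by
  simp only [dotProduct, Pi.star_apply, RCLike.star_def, Complex.conj_mul']
  push_cast
  rfl

lemma dotProduct_mul_conjTranspose_mulVec (H : Matrix (Fin N) (Fin M) ℂ) (x : Fin N → ℂ) :
    star x ⬝ᵥ ((H * Hᴴ) *ᵥ x) = ((∑ j, ‖(Hᴴ *ᵥ x) j‖ ^ 2 : ℝ) : ℂ) := by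
  rw [← dotProduct_star_self_eq_sum, Matrix.star_mulVec, Matrix.conjTranspose_conjTranspose,
    ← Matrix.dotProduct_mulVec, Matrix.mulVec_mulVec]

lemma eigenvalues_le_largestEig (H : Matrix (Fin N) (Fin M) ℂ) (i : Fin N) :
    (Matrix.isHermitian_mul_conjTranspose_self H).eigenvalues i ≤ largestEig H :=
  le_ciSup (f := (Matrix.isHermitian_mul_conjTranspose_self H).eigenvalues)
    (Set.finite_range _).bddAbove i

lemma largestEig_nonneg (H : Matrix (Fin N) (Fin M) ℂ) : 0 ≤ largestEig H :=
  Real.iSup_nonneg fun i => Matrix.eigenvalues_self_mul_conjTranspose_nonneg H i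

/-- The eigenvalues are nonnegative, so each is at most the trace. This supplies the integrable
majorant of the largest eigenvalue. -/
lemma largestEig_le_sum (H : Matrix (Fin N) (Fin M) ℂ) :
    largestEig H ≤ ∑ k : Fin N × Fin M, ‖H k.1 k.2‖ ^ 2 := by
  have h0 : 0 ≤ ∑ k : Fin N × Fin M, ‖H k.1 k.2‖ ^ 2 := by positivity
  refine Real.iSup_le (fun i => ?_) h0
  have ht := (Matrix.isHermitian_mul_conjTranspose_self H).trace_eq_sum_eigenvalues
  have ht' : (H * Hᴴ).trace = ((∑ k : Fin N × Fin M, ‖H k.1 k.2‖ ^ 2 : ℝ) : ℂ) := by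
    simp only [Matrix.trace, Matrix.diag_apply, Matrix.mul_apply, Matrix.conjTranspose_apply,
      RCLike.star_def, Complex.mul_conj', Fintype.sum_prod_type]
    push_cast
    rfl
  have hs : ∑ i, (Matrix.isHermitian_mul_conjTranspose_self H).eigenvalues i
      = ∑ k : Fin N × Fin M, ‖H k.1 k.2‖ ^ 2 := by
    rw [ht'] at ht
    simp only [Complex.coe_algebraMap] at ht
    exact_mod_cast ht.symm
  rw [← hs]
  exact Finset.single_le_sum
    (f := (Matrix.isHermitian_mul_conjTranspose_self H).eigenvalues)
    (fun j _ => Matrix.eigenvalues_self_mul_conjTranspose_nonneg H j) (Finset.mem_univ i)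

/-- Rayleigh quotient bound: in the eigenbasis coordinates `y = V* x` the quadratic form is `∑ λ_i
|y_i|²`, and `V` preserves the norm. -/
lemma sum_norm_sq_conjTranspose_mulVec_le (H : Matrix (Fin N) (Fin M) ℂ) (x : Fin N → ℂ) :
    ∑ j, ‖(Hᴴ *ᵥ x) j‖ ^ 2 ≤ largestEig H * ∑ i, ‖x i‖ ^ 2 := by
  set hA := Matrix.isHermitian_mul_conjTranspose_self H
  have hspec := hA.spectral_theorem
  rw [Unitary.conjStarAlgAut_apply] at hspec
  set V : Matrix (Fin N) (Fin N) ℂ := hA.eigenvectorUnitary.1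
  have hV : V * star V = 1 := Unitary.coe_mul_star_self hA.eigenvectorUnitary
  set y := star V *ᵥ x
  have hy : star y ⬝ᵥ y = star x ⬝ᵥ x := by
    rw [Matrix.star_mulVec, ← Matrix.dotProduct_mulVec, Matrix.mulVec_mulVec,
      Matrix.star_eq_conjTranspose, Matrix.conjTranspose_conjTranspose,
      ← Matrix.star_eq_conjTranspose, hV, Matrix.one_mulVec]
  have hxy : star x ⬝ᵥ ((H * Hᴴ) *ᵥ x) = ((∑ i, hA.eigenvalues i * ‖y i‖ ^ 2 : ℝ) : ℂ) := by
    refine (congrArg (fun A => star x ⬝ᵥ (A *ᵥ x)) hspec).trans ?_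
    rw [mul_assoc, ← Matrix.mulVec_mulVec, ← Matrix.mulVec_mulVec, Matrix.dotProduct_mulVec]
    have : star x ᵥ* V = star y := by
      rw [Matrix.star_mulVec, Matrix.star_eq_conjTranspose, Matrix.conjTranspose_conjTranspose]
    rw [this]
    simp only [dotProduct, Matrix.mulVec_diagonal, Pi.star_apply, RCLike.star_def]
    push_cast
    refine Finset.sum_congr rfl fun i _ => ?_
    rw [← Complex.conj_mul' (y i)]
    simp only [Function.comp_apply, Complex.coe_algebraMap, y]
    ring
  rw [dotProduct_mul_conjTranspose_mulVec, Complex.ofReal_inj] at hxy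
  rw [dotProduct_star_self_eq_sum, dotProduct_star_self_eq_sum, Complex.ofReal_inj] at hy
  rw [hxy, ← hy, Finset.mul_sum]
  exact Finset.sum_le_sum fun i _ =>
    mul_le_mul_of_nonneg_right (eigenvalues_le_largestEig H i) (by positivity)

lemma largestEig_le_of_forall (H : Matrix (Fin N) (Fin M) ℂ) {c : ℝ} (hc : 0 ≤ c)
    (h : ∀ x : Fin N → ℂ, ∑ j, ‖(Hᴴ *ᵥ x) j‖ ^ 2 ≤ c * ∑ i, ‖x i‖ ^ 2) : largestEig H ≤ c := by
  refine Real.iSup_le (fun i => ?_) hc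
  set hA := Matrix.isHermitian_mul_conjTranspose_self H
  have h1 := hA.eigenvalues_eq i
  rw [dotProduct_mul_conjTranspose_mulVec] at h1
  have h2 : ∑ k, ‖(hA.eigenvectorBasis i).ofLp k‖ ^ 2 = 1 := by
    rw [← EuclideanSpace.norm_sq_eq, hA.eigenvectorBasis.norm_eq_one, one_pow]
  have h3 := h (hA.eigenvectorBasis i).ofLp
  rw [h2, mul_one] at h3
  rw [h1]
  exact h3

/-- Describes sublevel sets without reference to eigenvectors, which makes measurability, scaling
and positivity accessible. The condition `0 ≤ c` matters for `N = 0`, where the supremum is 0 and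
the right side is vacuous. -/
lemma largestEig_le_iff (H : Matrix (Fin N) (Fin M) ℂ) {c : ℝ} (hc : 0 ≤ c) :
    largestEig H ≤ c ↔ ∀ x : Fin N → ℂ, ∑ j, ‖(Hᴴ *ᵥ x) j‖ ^ 2 ≤ c * ∑ i, ‖x i‖ ^ 2 := by
  refine ⟨fun h x => (sum_norm_sq_conjTranspose_mulVec_le H x).trans ?_,
    largestEig_le_of_forall H hc⟩
  exact mul_le_mul_of_nonneg_right h (by positivity)

lemma largestEig_smul (H : Matrix (Fin N) (Fin M) ℂ) {t : ℝ} (ht : t ≠ 0) :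
    largestEig (t • H) = t ^ 2 * largestEig H := by
  have key : ∀ (t : ℝ) (G : Matrix (Fin N) (Fin M) ℂ),
      largestEig (t • G) ≤ t ^ 2 * largestEig G := fun t G => by
    rw [largestEig_le_iff _ (mul_nonneg (sq_nonneg t) (largestEig_nonneg G))]
    intro x
    simp only [Matrix.conjTranspose_smul, Matrix.smul_mulVec, Pi.smul_apply, norm_smul, mul_pow,
      star_trivial, Real.norm_eq_abs, sq_abs, ← Finset.mul_sum, mul_assoc]
    exact mul_le_mul_of_nonneg_left (sum_norm_sq_conjTranspose_mulVec_le G x) (sq_nonneg t)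
  refine le_antisymm (key t H) ?_
  -- The reverse inequality is the same one for the inverse scaling.
  have h := key t⁻¹ (t • H)
  rw [smul_smul, inv_mul_cancel₀ ht, one_smul] at h
  calc t ^ 2 * largestEig H ≤ t ^ 2 * (t⁻¹ ^ 2 * largestEig (t • H)) :=
        mul_le_mul_of_nonneg_left h (sq_nonneg t)
    _ = largestEig (t • H) := by field_simp

lemma largestEig_pos {H : Matrix (Fin N) (Fin M) ℂ} (hH : H ≠ 0) : 0 < largestEig H := by
  refine (largestEig_nonneg H).lt_of_ne' fun h0 => hH ?_
  have h := (largestEig_le_iff H le_rfl).1 h0.le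
  rw [← Matrix.conjTranspose_eq_zero]
  refine Matrix.ext_of_mulVec_single fun i => ?_
  rw [Matrix.zero_mulVec]
  ext j
  have h1 := h (Pi.single i 1)
  rw [zero_mul] at h1
  have h2 := (Finset.sum_eq_zero_iff_of_nonneg (fun j _ => by positivity)).1
    (h1.antisymm (by positivity)) j (Finset.mem_univ j)
  simpa using h2

lemma measurable_wishartMaxEig (N M : ℕ) : Measurable (wishartMaxEig N M) := by
  refine measurable_of_Iic fun c => ?_
  rcases lt_or_ge c 0 with hc | hc
  · convert MeasurableSet.empty
    ext h
    exact iff_of_false (fun h' => absurd (hc.trans_le (largestEig_nonneg _)) (not_lt.2 h')) id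
  -- The intersection is uncountable, but each member is closed.
  · have : wishartMaxEig N M ⁻¹' Set.Iic c = ⋂ x : Fin N → ℂ,
        {h | ∑ j, ‖((Matrix.of fun i j => h (i, j))ᴴ *ᵥ x) j‖ ^ 2 ≤ c * ∑ i, ‖x i‖ ^ 2} := by
      ext h
      simp only [Set.mem_preimage, Set.mem_Iic, Set.mem_iInter, Set.mem_ofPred_eq]
      exact largestEig_le_iff _ hc
    rw [this]
    refine (isClosed_iInter fun x => isClosed_le ?_ continuous_const).measurableSet
    simp only [Matrix.mulVec, dotProduct, Matrix.conjTranspose_apply, Matrix.of_apply]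
    fun_prop

end

/-! ### Absolute continuity: density of the largest eigenvalue, almost sure invertibility -/

instance : IsProbabilityMeasure stdComplexGaussian :=
  Measure.isProbabilityMeasure_map (by fun_prop)

instance (N M : ℕ) : IsProbabilityMeasure (gaussianMatrixLaw N M) := by
  unfold gaussianMatrixLaw
  infer_instance

lemma stdComplexGaussian_absolutelyContinuous : stdComplexGaussian ≪ volume := by
  have h : (gaussianReal 0 (1 / 2)) ≪ volume := gaussianReal_absolutelyContinuous 0 (by simp)
  rw [stdComplexGaussian, ← Complex.volume_preserving_equiv_real_prod.symm.map_eq]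
  exact (h.prod h).map (MeasurableEquiv.measurable _)

lemma pi_fin_absolutelyContinuous {E : Type*} [MeasurableSpace E] {μ ν : Measure E}
    [SigmaFinite μ] [SigmaFinite ν] (h : μ ≪ ν) (n : ℕ) :
    Measure.pi (fun _ : Fin n => μ) ≪ Measure.pi fun _ : Fin n => ν := by
  induction n with
  | zero => rw [Measure.pi_of_empty _ Fin.elim0, Measure.pi_of_empty _ Fin.elim0]
  | succ n ih =>
    rw [← (measurePreserving_piFinSuccAbove (fun _ : Fin (n + 1) => μ) 0).symm.map_eq,
      ← (measurePreserving_piFinSuccAbove (fun _ : Fin (n + 1) => ν) 0).symm.map_eq]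
    exact (h.prod ih).map (MeasurableEquiv.measurable _)

lemma pi_absolutelyContinuous {ι E : Type*} [Fintype ι] [MeasurableSpace E] {μ ν : Measure E}
    [SigmaFinite μ] [SigmaFinite ν] (h : μ ≪ ν) :
    Measure.pi (fun _ : ι => μ) ≪ Measure.pi fun _ : ι => ν := by
  let e := (Fintype.equivFin ι).symm
  rw [← (measurePreserving_piCongrLeft (fun _ : ι => μ) e).map_eq,
    ← (measurePreserving_piCongrLeft (fun _ : ι => ν) e).map_eq]
  exact (pi_fin_absolutelyContinuous h _).map (MeasurableEquiv.measurable _)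

lemma gaussianMatrixLaw_absolutelyContinuous (N M : ℕ) : gaussianMatrixLaw N M ≪ volume :=
  pi_absolutelyContinuous stdComplexGaussian_absolutelyContinuous

/-- A measurable set `S` is null if almost every point is moved out of `S` by almost every member
of a measurable family of transformations, none of which pulls `S` back to a null set unless `S`
is null. -/
lemma measure_eq_zero_of_forall_ae_notMem {E : Type*} [MeasurableSpace E] {μ : Measure E}
    [SFinite μ] {S : Set E} (hS : MeasurableSet S) (T : ℝ → E → E)
    (hT : Measurable (Function.uncurry T))
    (hmem : ∀ᵐ x ∂μ, ∀ᵐ t : ℝ, T t x ∉ S)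
    (hpre : ∀ᵐ t : ℝ, μ (T t ⁻¹' S) = 0 → μ S = 0) : μ S = 0 := by
  have hms : MeasurableSet {q : E × ℝ | T q.2 q.1 ∉ S} :=
    (hT.comp measurable_swap) hS.compl
  -- Fubini exchanges the two quantifiers; a single good `t` then suffices.
  have h2 : ∀ᵐ t : ℝ, ∀ᵐ x ∂μ, T t x ∉ S := (Measure.ae_ae_comm hms).1 hmem
  obtain ⟨t, h3, h4⟩ := (h2.and hpre).exists
  refine h4 ?_
  rw [ae_iff] at h3
  simp only [not_not] at h3
  exact h3

/-- The moving family is `h ↦ exp t • h`, which multiplies the eigenvalue by `exp (2t)` and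
multiplies Lebesgue measure by a nonzero constant. -/
lemma volume_preimage_wishartMaxEig {N M : ℕ} (hN : 1 ≤ N) (hM : 1 ≤ M) {Z : Set ℝ}
    (hZ : MeasurableSet Z) (h0 : volume Z = 0) : volume (wishartMaxEig N M ⁻¹' Z) = 0 := by
  have : Nonempty (Fin N × Fin M) := ⟨⟨⟨0, hN⟩, ⟨0, hM⟩⟩⟩
  refine measure_eq_zero_of_forall_ae_notMem (measurable_wishartMaxEig N M hZ)
    (fun t h => Real.exp t • h) (by fun_prop) ?_ ?_
  · have hne : ∀ᵐ h : Fin N × Fin M → ℂ, h ≠ 0 := by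
      simp [ae_iff]
    filter_upwards [hne] with h hh
    have hc : 0 < wishartMaxEig N M h := by
      refine largestEig_pos fun h' => hh ?_
      ext k
      simpa using congrFun (congrFun h' k.1) k.2
    have hd : ∀ t : ℝ, wishartMaxEig N M (Real.exp t • h) = Real.exp t ^ 2 * wishartMaxEig N M h :=
      fun t => largestEig_smul (Matrix.of fun i j => h (i, j)) (Real.exp_ne_zero t)
    -- The bad parameters solve `exp (2t) λ = z` with `z ∈ Z`; they form a differentiable image of a
    -- null set.
    have himg : volume ((fun z => Real.log (z / wishartMaxEig N M h) / 2) '' (Z ∩ Set.Ioi 0)) = 0 := by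
      refine addHaar_image_eq_zero_of_differentiableOn_of_addHaar_eq_zero volume ?_
        (measure_mono_null Set.inter_subset_left h0)
      intro z hz
      have hz' : z / wishartMaxEig N M h ≠ 0 := (div_pos hz.2 hc).ne'
      exact (((differentiableAt_id.div_const _).log hz').div_const _).differentiableWithinAt
    filter_upwards [compl_mem_ae_iff.2 himg] with t ht hmem
    rw [Set.mem_preimage, hd] at hmem
    refine ht ⟨_, ⟨hmem, by simp only [Set.mem_Ioi]; positivity⟩, ?_⟩
    simp [mul_div_assoc, div_self hc.ne']
  · refine Filter.Eventually.of_forall fun t h => ?_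
    change volume ((Real.exp t • ·) ⁻¹' _) = 0 at h
    rw [Measure.addHaar_preimage_smul _ (Real.exp_ne_zero t)] at h
    exact (mul_eq_zero.1 h).resolve_left
      (ENNReal.ofReal_pos.2 (abs_pos.2 (inv_ne_zero (pow_ne_zero _ (Real.exp_ne_zero t))))).ne'

lemma hasPDF_wishartMaxEig {N M : ℕ} (hN : 1 ≤ N) (hM : 1 ≤ M) :
    HasPDF (wishartMaxEig N M) (gaussianMatrixLaw N M) volume := by
  have hm := measurable_wishartMaxEig N M
  refine ⟨hm.aemeasurable, inferInstance, Measure.AbsolutelyContinuous.mk fun Z hZ h0 => ?_⟩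
  rw [Measure.map_apply hm hZ]
  exact gaussianMatrixLaw_absolutelyContinuous N M (volume_preimage_wishartMaxEig hN hM hZ h0)

/-- Here the moving family is translation by `t I`: `det (t I + A)` is the characteristic polynomial
of `-A` at `t`, so only finitely many `t` are bad. -/
lemma ae_det_ne_zero (N : ℕ) :
    ∀ᵐ h ∂gaussianMatrixLaw N N, (Matrix.of fun i j => h (i, j)).det ≠ 0 := by
  refine (gaussianMatrixLaw_absolutelyContinuous N N).ae_le ?_
  have hm : MeasurableSet {h : Fin N × Fin N → ℂ | (Matrix.of fun i j => h (i, j)).det = 0} := by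
    refine (isClosed_eq ?_ continuous_const).measurableSet
    exact Continuous.matrix_det (by fun_prop)
  have h1 : volume {h : Fin N × Fin N → ℂ | (Matrix.of fun i j => h (i, j)).det = 0} = 0 := by
    refine measure_eq_zero_of_forall_ae_notMem hm
      (fun t h => (fun k => if k.1 = k.2 then (t : ℂ) else 0) + h) ?_ ?_ ?_
    · refine Continuous.measurable (Continuous.add (continuous_pi fun k => ?_) continuous_snd)
      by_cases hk : k.1 = k.2
      · simpa only [hk, if_true] using! Complex.continuous_ofReal.comp continuous_fst
      · simpa only [hk, if_false] using continuous_const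
    · refine Filter.Eventually.of_forall fun h => ?_
      have hfin : (((-Matrix.of fun i j => h (i, j)).charpoly.roots.toFinset : Set ℂ)).Finite :=
        Finset.finite_toSet _
      have h2 := (hfin.preimage (Complex.ofReal_injective.injOn)).measure_zero volume
      have h3 := compl_mem_ae_iff.2 h2
      filter_upwards [h3] with t ht h4
      apply ht
      simp only [Set.mem_preimage, Finset.mem_coe, Multiset.mem_toFinset]
      rw [Polynomial.mem_roots (Matrix.charpoly_monic _).ne_zero, Polynomial.IsRoot.def,
        Matrix.eval_charpoly, ← h4]
      congr 1
      ext i j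
      simp [Matrix.scalar_apply, Matrix.diagonal_apply]
    · refine Filter.Eventually.of_forall fun t h => ?_
      rwa [measure_preimage_add] at h
  exact ae_iff.2 (by simpa only [ne_eq, not_not] using h1)

/-! ### Unitary invariance and the exponential law of `|z|²` -/

lemma charFun_stdComplexGaussian (t : ℂ) :
    charFun stdComplexGaussian t = Complex.exp (-((‖t‖ ^ 2 / 4 : ℝ) : ℂ)) := by
  have h : charFun stdComplexGaussian t =
      charFun (gaussianReal 0 (1 / 2)) t.re * charFun (gaussianReal 0 (1 / 2)) t.im := by
    rw [charFun_apply, stdComplexGaussian, integral_map_equiv]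
    simp only [charFun_apply]
    rw [← integral_prod_mul]
    refine integral_congr_ae (Filter.Eventually.of_forall fun x => ?_)
    simp only [← Complex.exp_add]
    congr 1
    simp [Complex.inner]
    ring
  rw [h, charFun_gaussianReal, charFun_gaussianReal, ← Complex.exp_add]
  congr 1
  rw [← Complex.normSq_eq_norm_sq, Complex.normSq_apply]
  push_cast
  ring

lemma charFun_pi_stdComplexGaussian {ι : Type*} [Fintype ι] (t : PiLp 2 fun _ : ι => ℂ) :
    charFun ((Measure.pi fun _ : ι => stdComplexGaussian).map (WithLp.toLp 2)) t =
      Complex.exp (-(((∑ i, ‖t i‖ ^ 2) / 4 : ℝ) : ℂ)) := by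
  rw [charFun_pi]
  simp only [charFun_stdComplexGaussian, ← Complex.exp_sum, Finset.sum_neg_distrib,
    Finset.sum_div]
  push_cast
  rfl

/-- A standard complex Gaussian vector is mapped to a standard complex Gaussian vector by every
matrix with orthonormal rows. -/
lemma map_mulVec_pi_stdComplexGaussian {ι κ : Type*} [Fintype ι] [Fintype κ] [DecidableEq κ]
    (A : Matrix κ ι ℂ) (hA : A * Aᴴ = 1) :
    (Measure.pi fun _ : ι => stdComplexGaussian).map (fun x => A *ᵥ x) =
      Measure.pi fun _ : κ => stdComplexGaussian := by
  have hm : Measurable fun x : ι → ℂ => A *ᵥ x := by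
    refine Continuous.measurable ?_
    fun_prop
  have hinj : Function.Injective (Measure.map (WithLp.toLp 2 : (κ → ℂ) → PiLp 2 fun _ : κ => ℂ)) :=
    (MeasurableEquiv.toLp 2 (κ → ℂ)).map_measurableEquiv_injective
  have : IsProbabilityMeasure ((Measure.pi fun _ : ι => stdComplexGaussian).map (fun x => A *ᵥ x)) :=
    Measure.isProbabilityMeasure_map hm.aemeasurable
  apply hinj
  refine Measure.ext_of_charFun ?_
  ext t
  rw [charFun_pi_stdComplexGaussian]
  -- Moving `A` across the inner product evaluates the characteristic function at `Aᴴ t`, which has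
  -- the same norm as `t` because `A Aᴴ = 1`.
  have h1 : charFun (((Measure.pi fun _ : ι => stdComplexGaussian).map (fun x => A *ᵥ x)).map
      (WithLp.toLp 2)) t = charFun ((Measure.pi fun _ : ι => stdComplexGaussian).map
      (WithLp.toLp 2)) (WithLp.toLp 2 (Aᴴ *ᵥ t.ofLp)) := by
    rw [charFun_apply, charFun_apply, Measure.map_map (by fun_prop) hm,
      integral_map (by fun_prop) (by fun_prop), integral_map (by fun_prop) (by fun_prop)]
    refine integral_congr_ae (Filter.Eventually.of_forall fun x => ?_)
    simp only
    congr 3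
    simp only [Function.comp_apply, PiLp.inner_apply, Complex.inner, ← Complex.re_sum]
    congr 1
    have h2 : star (A *ᵥ x) ⬝ᵥ t.ofLp = star x ⬝ᵥ (Aᴴ *ᵥ t.ofLp) := by
      rw [Matrix.star_mulVec, ← Matrix.dotProduct_mulVec]
    simpa only [dotProduct, Pi.star_apply, RCLike.star_def, mul_comm] using h2
  rw [h1, charFun_pi_stdComplexGaussian]
  congr 4
  have h3 : star (Aᴴ *ᵥ t.ofLp) ⬝ᵥ (Aᴴ *ᵥ t.ofLp) = star t.ofLp ⬝ᵥ t.ofLp := by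
    rw [Matrix.star_mulVec, Matrix.conjTranspose_conjTranspose, ← Matrix.dotProduct_mulVec,
      Matrix.mulVec_mulVec, hA, Matrix.one_mulVec]
  rw [dotProduct_star_self_eq_sum, dotProduct_star_self_eq_sum, Complex.ofReal_inj] at h3
  exact h3

lemma lintegral_stdComplexGaussian (f : ℂ → ENNReal) (hf : Measurable f) :
    ∫⁻ z, f z ∂stdComplexGaussian =
      ∫⁻ z, ENNReal.ofReal (Real.pi⁻¹ * Real.exp (-‖z‖ ^ 2)) * f z := by
  have hv : (1 / 2 : ℝ≥0) ≠ 0 := by simp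
  have hg : Measurable fun p : ℝ × ℝ =>
      gaussianPDF 0 (1 / 2) p.1 * gaussianPDF 0 (1 / 2) p.2 := by fun_prop
  rw [stdComplexGaussian, lintegral_map_equiv, gaussianReal_of_var_ne_zero _ hv,
    prod_withDensity (by fun_prop) (by fun_prop), ← Measure.volume_eq_prod,
    lintegral_withDensity_eq_lintegral_mul _ hg
      (g := fun p => f (Complex.measurableEquivRealProd.symm p))
      (hf.comp (MeasurableEquiv.measurable _)),
    ← Complex.volume_preserving_equiv_real_prod.symm.lintegral_comp_emb
      Complex.measurableEquivRealProd.symm.measurableEmbedding]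
  refine lintegral_congr fun p => ?_
  simp only [Pi.mul_apply, gaussianPDF]
  rw [← ENNReal.ofReal_mul (gaussianPDFReal_nonneg _ _ _)]
  congr 2
  rw [gaussianPDFReal, gaussianPDFReal, ← Complex.normSq_eq_norm_sq, Complex.normSq_apply]
  have hp := Real.mul_self_sqrt Real.pi_pos.le
  have h2 : 2 * Real.pi * ((1 / 2 : ℝ≥0) : ℝ) = Real.pi := by
    push_cast
    ring
  rw [h2, mul_mul_mul_comm, ← mul_inv, hp, ← Real.exp_add]
  congr 2
  simp
  ring

/-- In polar coordinates the density is `π⁻¹ exp (-r²) r dr dθ`. The angle contributes `2π`, and `u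
= r²` turns `2 r exp (-r²) dr` into `exp (-u) du`. -/
lemma map_norm_sq_stdComplexGaussian :
    stdComplexGaussian.map (fun z => ‖z‖ ^ 2) = expMeasure 1 := by
  have hm : Measurable fun z : ℂ => ‖z‖ ^ 2 := by fun_prop
  ext s hs
  set g : ℝ → ENNReal := s.indicator 1
  have hgm : Measurable g := measurable_one.indicator hs
  have h1 : stdComplexGaussian.map (fun z => ‖z‖ ^ 2) s =
      ∫⁻ z, g (‖z‖ ^ 2) ∂stdComplexGaussian := by
    rw [← lintegral_indicator_one hs, lintegral_map hgm hm]
  have h2 : expMeasure 1 s = ∫⁻ u in Set.Ioi (0 : ℝ), ENNReal.ofReal (Real.exp (-u)) * g u := by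
    rw [expMeasure, gammaMeasure, withDensity_apply _ hs, ← lintegral_indicator hs,
      ← lintegral_indicator measurableSet_Ioi]
    have hz : ∀ᵐ u : ℝ, u ≠ 0 := by simp [ae_iff]
    refine lintegral_congr_ae ?_
    filter_upwards [hz] with u hu
    change s.indicator (exponentialPDF 1) u = _
    rcases lt_or_gt_of_ne hu with h | h
    · by_cases hus : u ∈ s <;> simp [hus, exponentialPDF_of_neg h, h.le]
    · by_cases hus : u ∈ s <;> simp [hus, exponentialPDF_of_nonneg h.le, h, g]
  have h3 : ∫⁻ u in Set.Ioi (0 : ℝ), ENNReal.ofReal (Real.exp (-u)) * g u =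
      ∫⁻ r in Set.Ioi (0 : ℝ), ENNReal.ofReal (2 * r) *
        (ENNReal.ofReal (Real.exp (-r ^ 2)) * g (r ^ 2)) := by
    have himg : (fun r : ℝ => r ^ 2) '' Set.Ioi 0 = Set.Ioi 0 := by
      ext u
      constructor
      · rintro ⟨r, hr, rfl⟩
        exact pow_pos (Set.mem_Ioi.1 hr) 2
      · intro hu
        exact ⟨Real.sqrt u, Real.sqrt_pos.2 hu, Real.sq_sqrt (le_of_lt hu)⟩
    have hinj : Set.InjOn (fun r : ℝ => r ^ 2) (Set.Ioi 0) := fun a ha b hb hab =>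
      (pow_left_inj₀ (le_of_lt ha) (le_of_lt hb) two_ne_zero).1 hab
    conv_lhs => rw [← himg]
    rw [lintegral_image_eq_lintegral_abs_deriv_mul measurableSet_Ioi
      (fun r _ => (hasDerivAt_pow 2 r).hasDerivWithinAt) hinj]
    refine setLIntegral_congr_fun measurableSet_Ioi fun r hr => ?_
    have hr' : (0 : ℝ) < r := hr
    simp [abs_of_pos hr']
  rw [h1, h2, h3, lintegral_stdComplexGaussian (fun z => g (‖z‖ ^ 2)) (hgm.comp hm),
    ← Complex.lintegral_comp_polarCoord_symm]
  have h4 : polarCoord.target = Set.Ioi (0 : ℝ) ×ˢ Set.Ioo (-Real.pi) Real.pi := rfl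
  simp only [Complex.norm_polarCoord_symm, sq_abs, smul_eq_mul]
  set F : ℝ → ENNReal := fun r =>
    ENNReal.ofReal r * (ENNReal.ofReal (Real.pi⁻¹ * Real.exp (-r ^ 2)) * g (r ^ 2))
  have hF : Measurable F := by
    have hg2 : Measurable fun r : ℝ => g (r ^ 2) := hgm.comp (by fun_prop)
    fun_prop
  change ∫⁻ p in polarCoord.target, F p.1 = _
  rw [h4, Measure.volume_eq_prod, ← Measure.prod_restrict,
    lintegral_prod (fun p : ℝ × ℝ => F p.1) (hF.comp measurable_fst).aemeasurable]
  refine setLIntegral_congr_fun measurableSet_Ioi fun r hr => ?_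
  have hr' : (0 : ℝ) < r := hr
  simp only [lintegral_const, Measure.restrict_apply_univ, Real.volume_Ioo, F]
  have h5 : ∀ a b c d : ENNReal, a * (b * c) * d = a * b * d * c := fun a b c d => by ring
  rw [h5, ← mul_assoc, ← ENNReal.ofReal_mul hr'.le, ← ENNReal.ofReal_mul (by positivity),
    ← ENNReal.ofReal_mul (by positivity)]
  congr 2
  field_simp
  ring

lemma IsRayleighChannel.hasLaw_entries {Ω : Type*} [MeasurableSpace Ω] {P : Measure Ω} {N M : ℕ}
    {H : Ω → Matrix (Fin N) (Fin M) ℂ} (hH : IsRayleighChannel H P) :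
    HasLaw (fun ω k => H ω k.1 k.2) (gaussianMatrixLaw N M) P :=
  hH.indep.hasLaw_pi fun k => hH.law k.1 k.2

open scoped Kronecker in
-- On the vector of entries, right multiplication by `U` is the matrix `I ⊗ Uᵀ`, whose rows are
-- orthonormal.
lemma map_mul_unitary_gaussianMatrixLaw {N M : ℕ} {U : Matrix (Fin M) (Fin M) ℂ}
    (hU : U ∈ Matrix.unitaryGroup (Fin M) ℂ) :
    (gaussianMatrixLaw N M).map (fun h k => ((Matrix.of fun i j => h (i, j)) * U) k.1 k.2) =
      gaussianMatrixLaw N M := by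
  set A : Matrix (Fin N × Fin M) (Fin N × Fin M) ℂ := (1 : Matrix (Fin N) (Fin N) ℂ) ⊗ₖ Uᵀ
  have hA : A * Aᴴ = 1 := by
    have h1 : Uᵀ * Uᵀᴴ = 1 := by
      have h2 : Uᴴ * U = 1 := (Matrix.mem_unitaryGroup_iff').1 hU
      have h3 := congrArg Matrix.transpose h2
      rw [Matrix.transpose_mul, Matrix.transpose_one] at h3
      rw [← h3, Matrix.conjTranspose, Matrix.conjTranspose, Matrix.transpose_map]
    rw [Matrix.conjTranspose_kronecker, ← Matrix.mul_kronecker_mul, h1]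
    simp
  have h := map_mulVec_pi_stdComplexGaussian A hA
  rw [gaussianMatrixLaw]
  convert h using 2
  ext h k
  simp [A, Matrix.mulVec, dotProduct, Matrix.mul_apply, Fintype.sum_prod_type, Matrix.one_apply,
    mul_comm]

/-- After normalization, the linear form is a one-row matrix with orthonormal rows, so its value is
again `CN(0,1)`. -/
lemma map_norm_sq_linear_pi_stdComplexGaussian {ι : Type*} [Fintype ι] (c : ι → ℂ)
    (hc : ∑ i, ‖c i‖ ^ 2 ≠ 0) :
    (Measure.pi fun _ : ι => stdComplexGaussian).map
      (fun y => ‖∑ i, y i * c i‖ ^ 2 / ∑ i, ‖c i‖ ^ 2) = expMeasure 1 := by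
  set S := ∑ i, ‖c i‖ ^ 2
  have hS : 0 < S := lt_of_le_of_ne (Finset.sum_nonneg fun i _ => by positivity) hc.symm
  set A : Matrix Unit ι ℂ := Matrix.of fun _ i => ((Real.sqrt S : ℝ) : ℂ)⁻¹ * c i
  have hA : A * Aᴴ = 1 := by
    ext
    simp only [A, Matrix.mul_apply, Matrix.conjTranspose_apply, Matrix.of_apply, Matrix.one_apply,
      if_true, RCLike.star_def, Complex.mul_conj']
    have h1 : ∑ i, ‖((Real.sqrt S : ℝ) : ℂ)⁻¹ * c i‖ ^ 2 = 1 := by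
      simp only [norm_mul, mul_pow, norm_inv, Complex.norm_real, Real.norm_eq_abs, sq_abs, inv_pow,
        Real.sq_sqrt hS.le, ← Finset.mul_sum]
      exact inv_mul_cancel₀ hS.ne'
    exact_mod_cast h1
  conv_rhs => rw [← map_norm_sq_stdComplexGaussian,
    ← (measurePreserving_eval (fun _ : Unit => stdComplexGaussian) ()).map_eq,
    ← map_mulVec_pi_stdComplexGaussian A hA, Measure.map_map (by fun_prop) (by fun_prop),
    Measure.map_map (by fun_prop) (Continuous.measurable (by fun_prop))]
  congr 1
  ext y
  simp only [Function.comp_apply, Function.eval, Matrix.mulVec, dotProduct, A, Matrix.of_apply,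
    mul_assoc, ← Finset.mul_sum, norm_mul, mul_pow, norm_inv, Complex.norm_real, Real.norm_eq_abs,
    sq_abs, inv_pow, Real.sq_sqrt hS.le]
  simp only [mul_comm (c _)]
  field_simp

/-! ### Square channels: the law of `1/‖v‖²` -/

/-- The reciprocal squared norm of the solution `v` of `Aᵀ v = e_m`, as a function of the entries
of `A`. -/
def invNormSq {N : ℕ} (m : Fin N) (b : Fin N × Fin N → ℂ) : ℝ :=
  ‖(Matrix.of fun k i => b (i, k)).det‖ ^ 2 /
    ∑ i, ‖(Matrix.of fun k i => b (i, k)).adjugate i m‖ ^ 2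

lemma measurable_invNormSq {N : ℕ} (m : Fin N) : Measurable (invNormSq m) := by
  have h1 : Continuous fun b : Fin N × Fin N → ℂ => (Matrix.of fun k i => b (i, k)) := by
    fun_prop
  have h2 : ∀ i, Continuous fun b : Fin N × Fin N → ℂ =>
      (Matrix.of fun k i => b (i, k)).adjugate i m := fun i =>
    (h1.matrix_adjugate).matrix_elem i m
  have h3 := h1.matrix_det
  unfold invNormSq
  exact (h3.norm.pow 2).measurable.div
    (Finset.measurable_sum _ fun i _ => ((h2 i).norm.pow 2).measurable)

lemma ae_det_transpose_ne_zero {N : ℕ} : ∀ᵐ b ∂gaussianMatrixLaw N N,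
    (Matrix.of fun k i => b (i, k)).det ≠ 0 := by
  filter_upwards [ae_det_ne_zero N] with b hb
  rwa [← Matrix.det_transpose]

lemma map_invNormSq_gaussianMatrixLaw {N : ℕ} (m : Fin N) :
    (gaussianMatrixLaw N N).map (invNormSq m) = expMeasure 1 := by
  -- Separates column `m` (the variable `y`) from the other columns (the variable `z`).
  set e := MeasurableEquiv.piEquivPiSubtypeProd (fun _ : Fin N × Fin N => ℂ) (fun k => k.2 ≠ m)
  have he : MeasurePreserving e (gaussianMatrixLaw N N) _ :=
    measurePreserving_piEquivPiSubtypeProd (fun _ : Fin N × Fin N => stdComplexGaussian)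
      (fun k => k.2 ≠ m)
  set D : ({k : Fin N × Fin N // k.2 ≠ m} → ℂ) → ({k : Fin N × Fin N // ¬ k.2 ≠ m} → ℂ) →
    Matrix (Fin N) (Fin N) ℂ := fun z y => Matrix.of fun k i => e.symm (z, y) (i, k)
  set c : ({k : Fin N × Fin N // k.2 ≠ m} → ℂ) → ({k : Fin N × Fin N // ¬ k.2 ≠ m} → ℂ) :=
    fun z k => (D z 0).adjugate k.1.1 m
  let φ : Fin N → {k : Fin N × Fin N // ¬ k.2 ≠ m} := fun i => ⟨(i, m), by simp⟩
  have hφ : Function.Bijective φ := by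
    refine ⟨fun i j hij => ?_, fun k => ⟨k.1.1, ?_⟩⟩
    · simpa [φ] using hij
    · obtain ⟨⟨i, j⟩, hk⟩ := k
      simp only [ne_eq, not_not] at hk
      subst hk
      rfl
  -- These cofactors delete column `m` of `b`, so they do not depend on `y` and may be computed at
  -- `y = 0`.
  have hadj : ∀ z y i, (D z y).adjugate i m = c z (φ i) := fun z y i => by
    simp only [c, φ, Matrix.adjugate_apply]
    congr 1
    ext k j
    by_cases hk : k = m
    · subst hk
      simp
    · simp [D, e, MeasurableEquiv.piEquivPiSubtypeProd,
        Equiv.piEquivPiSubtypeProd, hk]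
  have hDm : ∀ z y i, D z y m i = y (φ i) := fun z y i => by
    simp [D, e, φ, MeasurableEquiv.piEquivPiSubtypeProd, Equiv.piEquivPiSubtypeProd]
  have hdet : ∀ z y, (D z y).det = ∑ k, y k * c z k := fun z y => by
    rw [Matrix.det_eq_sum_mul_adjugate_row _ m]
    simp only [hadj, hDm]
    exact hφ.sum_comp fun k => y k * c z k
  have hF : ∀ z y, invNormSq m (e.symm (z, y)) =
      ‖∑ k, y k * c z k‖ ^ 2 / ∑ k, ‖c z k‖ ^ 2 := fun z y => by
    rw [← hdet, ← hφ.sum_comp fun k => ‖c z k‖ ^ 2]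
    simp only [← hadj z y]
    rfl
  -- If all these cofactors vanished, the determinant would be zero for every `y`, contrary to
  -- almost sure invertibility.
  have hne : ∀ᵐ z ∂(Measure.pi fun _ : {k : Fin N × Fin N // k.2 ≠ m} => stdComplexGaussian),
      ∑ k, ‖c z k‖ ^ 2 ≠ 0 := by
    have h1 := he.symm.quasiMeasurePreserving.ae (ae_det_transpose_ne_zero (N := N))
    have h2 := Measure.ae_ae_of_ae_prod h1
    filter_upwards [h2] with z hz h0
    obtain ⟨y, hy⟩ := hz.exists
    apply hy
    change (D z y).det = 0
    rw [hdet]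
    refine Finset.sum_eq_zero fun k hk => ?_
    have := (Finset.sum_eq_zero_iff_of_nonneg (fun j _ => by positivity)).1 h0 k hk
    simp_all
  ext s hs
  have hms : MeasurableSet (invNormSq m ⁻¹' s) := measurable_invNormSq m hs
  rw [Measure.map_apply (measurable_invNormSq m) hs, ← he.symm.measure_preimage hms.nullMeasurableSet,
    Measure.prod_apply (e.symm.measurable hms)]
  -- The conditional law given `z` is the same for almost every `z`, hence it is the unconditional
  -- law.
  rw [lintegral_congr_ae (g := fun _ => expMeasure 1 s)]
  · simp
  · filter_upwards [hne] with z hz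
    rw [← map_norm_sq_linear_pi_stdComplexGaussian (c z) hz, Measure.map_apply (by fun_prop) hs]
    congr 1
    ext y
    simp [hF]

/-- Cramer's rule: conjugation gives `(H U)ᵀ v̄ = e_m`, and applying the adjugate gives `det · v̄`
as its column `m`. The conjugate disappears in norms. -/
lemma one_div_norm_sq_eq_invNormSq {N : ℕ} {H U : Matrix (Fin N) (Fin N) ℂ}
    (hU : U ∈ Matrix.unitaryGroup (Fin N) ℂ) (m : Fin N) {v : EuclideanSpace ℂ (Fin N)}
    (hv : Hᴴ *ᵥ v.ofLp = fun i => U i m) (hdet : (H * U).det ≠ 0) :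
    1 / ‖v‖ ^ 2 = invNormSq m fun k => (H * U) k.1 k.2 := by
  have hB : (H * U)ᴴ *ᵥ v.ofLp = Pi.single m 1 := by
    have h2 : Uᴴ * U = 1 := (Matrix.mem_unitaryGroup_iff').1 hU
    rw [Matrix.conjTranspose_mul, ← Matrix.mulVec_mulVec, hv]
    ext k
    have := congrFun (congrFun h2 k) m
    rw [Matrix.one_apply, Matrix.mul_apply] at this
    rw [Pi.single_apply]
    exact this
  have hBT : (H * U)ᵀ *ᵥ star v.ofLp = Pi.single m 1 := by
    have := congrArg star hB
    rw [Matrix.star_mulVec, Matrix.conjTranspose_conjTranspose] at this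
    rw [Matrix.mulVec_transpose, this]
    ext k
    simp [Pi.single_apply, apply_ite]
  have h1 := congrArg ((H * U)ᵀ.adjugate *ᵥ ·) hBT
  simp only [Matrix.mulVec_mulVec, Matrix.adjugate_mul, Matrix.smul_mulVec, Matrix.one_mulVec] at h1
  have h2 : ∑ i, ‖(H * U)ᵀ.adjugate i m‖ ^ 2 = ‖(H * U)ᵀ.det‖ ^ 2 * ‖v‖ ^ 2 := by
    rw [EuclideanSpace.norm_sq_eq, Finset.mul_sum]
    refine Finset.sum_congr rfl fun i _ => ?_
    have := congrFun h1 i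
    simp only [Pi.smul_apply, Pi.star_apply, smul_eq_mul, Matrix.mulVec_single_one, Matrix.col_apply] at this
    rw [← this, norm_mul, norm_star, mul_pow]
  have h3 : ‖(H * U)ᵀ.det‖ ^ 2 ≠ 0 := by
    rw [Matrix.det_transpose]
    simpa using hdet
  change _ = ‖(H * U)ᵀ.det‖ ^ 2 / ∑ i, ‖(H * U)ᵀ.adjugate i m‖ ^ 2
  rw [h2, div_mul_eq_div_div, div_self h3]

theorem IsDetector.hasLaw_one_div_norm_sq {Ω : Type*} [MeasurableSpace Ω] {P : Measure Ω} {N : ℕ}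
    {H : Ω → Matrix (Fin N) (Fin N) ℂ} (hH : IsRayleighChannel H P)
    {U : Matrix (Fin N) (Fin N) ℂ} (hU : U ∈ Matrix.unitaryGroup (Fin N) ℂ) (m : Fin N)
    {v : Ω → EuclideanSpace ℂ (Fin N)} (hv : IsDetector P H (fun i => U i m) v) :
    HasLaw (fun ω => 1 / ‖v ω‖ ^ 2) (expMeasure 1) P := by
  have h1 : HasLaw (fun h k => ((Matrix.of fun i j => h (i, j)) * U) k.1 k.2)
      (gaussianMatrixLaw N N) (gaussianMatrixLaw N N) :=
    ⟨by
      simp only [Matrix.mul_apply, Matrix.of_apply]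
      exact (Continuous.measurable (by fun_prop)).aemeasurable, map_mul_unitary_gaussianMatrixLaw hU⟩
  have h2 : HasLaw (invNormSq m) (expMeasure 1) (gaussianMatrixLaw N N) :=
    ⟨(measurable_invNormSq m).aemeasurable, map_invNormSq_gaussianMatrixLaw m⟩
  have h3 := h1.comp hH.hasLaw_entries
  refine (h2.comp h3).congr ?_
  have h4 := (h3.ae_iff (p := fun b => (Matrix.of fun i j => b (i, j)).det ≠ 0) ?_).2
    (ae_det_ne_zero N)
  · filter_upwards [hv.2, h4] with ω hω hd
    exact one_div_norm_sq_eq_invNormSq hU m hω hd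
  · refine (measurableSet_singleton (0 : ℂ)).compl.mem.comp (Continuous.measurable ?_)
    exact Continuous.matrix_det (by fun_prop)

/-! ### Logarithmic moments of the exponential law and `Ei` -/

lemma integrableOn_log_mul_exp_neg {a : ℝ} (ha : 0 ≤ a) :
    IntegrableOn (fun x => Real.log (1 + a * x) * Real.exp (-x)) (Set.Ioi 0) := by
  have h1 : IntegrableOn (fun x : ℝ => a * (x * Real.exp (-x))) (Set.Ioi 0) := by
    have := Real.GammaIntegral_convergent (s := 2) (by norm_num)
    refine IntegrableOn.congr_fun (this.const_mul a) (fun x hx => ?_) measurableSet_Ioi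
    norm_num [mul_comm]
  refine h1.mono' (by fun_prop) ((ae_restrict_mem measurableSet_Ioi).mono fun x hx => ?_)
  have hx0 : (0 : ℝ) < x := hx
  have h2 : 0 ≤ a * x := by positivity
  rw [norm_mul, Real.norm_of_nonneg (Real.log_nonneg (by linarith)),
    Real.norm_of_nonneg (Real.exp_pos _).le, ← mul_assoc]
  gcongr
  linarith [Real.log_le_sub_one_of_pos (show 0 < 1 + a * x by linarith)]

lemma integrableOn_div_mul_exp_neg {a : ℝ} (ha : 0 < a) :
    IntegrableOn (fun x => a / (1 + a * x) * Real.exp (-x)) (Set.Ioi 0) := by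
  have h1 : IntegrableOn (fun x : ℝ => a * Real.exp (-x)) (Set.Ioi 0) :=
    (integrableOn_exp_neg_Ioi 0).const_mul a
  refine h1.mono' (by fun_prop) ((ae_restrict_mem measurableSet_Ioi).mono fun x hx => ?_)
  have hx0 : (0 : ℝ) < x := hx
  rw [Real.norm_of_nonneg (by positivity)]
  gcongr
  exact div_le_self ha.le (by nlinarith)

/-- The substitution `t = -(x + 1/a)` carries `Ei (-1/a)` to the half-line and releases a factor
`exp (-1/a)`, cancelled by the prefactor of `expEi`. -/
lemma integral_div_mul_exp_neg {a : ℝ} (ha : 0 < a) :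
    ∫ x in Set.Ioi 0, a / (1 + a * x) * Real.exp (-x) = -expEi a := by
  have h1 : ∫ t in Set.Iic (-(1 / a)), Real.exp t / t =
      ∫ x in Set.Ioi 0, Real.exp (-(x + 1 / a)) / -(x + 1 / a) := by
    have h := integral_comp_neg_Ioi (1 / a) fun t => Real.exp t / t
    rw [← h]
    have h2 := (measurePreserving_add_right volume (1 / a)).setIntegral_preimage_emb
      (measurableEmbedding_addRight (1 / a)) (fun t => Real.exp (-t) / -t) (Set.Ioi (1 / a))
    rw [← h2]
    simp
  rw [expEi, if_pos ha, Ei, h1, ← integral_const_mul, ← integral_neg]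
  refine setIntegral_congr_fun measurableSet_Ioi fun x hx => ?_
  have hx0 : (0 : ℝ) < x := hx
  have h2 : -(x + 1 / a) = -((1 + a * x) / a) := by
    field_simp
    ring
  have h3 : Real.exp (-(x + 1 / a)) = Real.exp (-x) * (Real.exp (1 / a))⁻¹ := by
    rw [neg_add, Real.exp_add, Real.exp_neg (1 / a)]
  have h4 : 1 + a * x ≠ 0 := by positivity
  have h5 := (Real.exp_pos (1 / a)).ne'
  rw [h3, h2]
  generalize Real.exp (1 / a) = E at h5
  field_simp

lemma tendsto_log_mul_exp_neg {a : ℝ} (ha : 0 ≤ a) :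
    Filter.Tendsto (fun x => Real.log (1 + a * x) * Real.exp (-x)) Filter.atTop (nhds 0) := by
  have h1 : Filter.Tendsto (fun x : ℝ => a * (x ^ 1 * Real.exp (-x))) Filter.atTop (nhds (a * 0)) :=
    (Real.tendsto_pow_mul_exp_neg_atTop_nhds_zero 1).const_mul a
  rw [mul_zero] at h1
  refine squeeze_zero' ?_ ?_ h1
  · filter_upwards [Filter.eventually_ge_atTop 0] with x hx
    have h2 : 0 ≤ a * x := by positivity
    exact mul_nonneg (Real.log_nonneg (by linarith)) (Real.exp_pos _).le
  · filter_upwards [Filter.eventually_ge_atTop 0] with x hx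
    have h2 : 0 ≤ a * x := by positivity
    rw [pow_one, ← mul_assoc]
    gcongr
    linarith [Real.log_le_sub_one_of_pos (show 0 < 1 + a * x by linarith)]

lemma integral_log_mul_exp_neg {a : ℝ} (ha : 0 ≤ a) :
    ∫ x in Set.Ioi 0, Real.log (1 + a * x) * Real.exp (-x) = -expEi a := by
  rcases ha.eq_or_lt with rfl | ha'
  · simp [expEi]
  rw [← integral_div_mul_exp_neg ha', ← sub_eq_zero,
    ← integral_sub (integrableOn_log_mul_exp_neg ha) (integrableOn_div_mul_exp_neg ha')]
  -- Integration by parts: the difference of the integrands is the derivative of a function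
  -- vanishing at both 0 and infinity.
  have hder : ∀ x ∈ Set.Ici (0 : ℝ), HasDerivAt (fun x => -(Real.log (1 + a * x) * Real.exp (-x)))
      (Real.log (1 + a * x) * Real.exp (-x) - a / (1 + a * x) * Real.exp (-x)) x := fun x hx => by
    have hx0 : (0 : ℝ) ≤ x := hx
    have h1 : HasDerivAt (fun x => 1 + a * x) a x := by
      simpa using ((hasDerivAt_id x).const_mul a).const_add 1
    have h2 : HasDerivAt (fun x => Real.exp (-x)) (Real.exp (-x) * -1) x :=
      (hasDerivAt_neg x).exp
    exact ((h1.log (by positivity)).mul h2).neg.congr_deriv (by ring)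
  have h := integral_Ioi_of_hasDerivAt_of_tendsto' hder
    ((integrableOn_log_mul_exp_neg ha).sub (integrableOn_div_mul_exp_neg ha'))
    (tendsto_log_mul_exp_neg ha).neg
  simpa using h

lemma integral_expMeasure_one (f : ℝ → ℝ) :
    ∫ x, f x ∂expMeasure 1 = ∫ x in Set.Ioi 0, f x * Real.exp (-x) := by
  have hm : Measurable (gammaPDF 1 1) := (measurable_gammaPDFReal 1 1).ennreal_ofReal
  rw [expMeasure, gammaMeasure, integral_withDensity_eq_integral_toReal_smul hm (by simp [gammaPDF]),
    ← integral_indicator measurableSet_Ioi]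
  have hz : ∀ᵐ u : ℝ, u ≠ 0 := by simp [ae_iff]
  refine integral_congr_ae ?_
  filter_upwards [hz] with u hu
  change (exponentialPDF 1 u).toReal • f u = _
  rcases lt_or_gt_of_ne hu with h | h
  · simp [exponentialPDF_of_neg h, h.le]
  · simp [exponentialPDF_of_nonneg h.le, h, (Real.exp_pos _).le, mul_comm]

lemma integral_logb_expMeasure_one {a : ℝ} (ha : 0 ≤ a) :
    ∫ x, Real.logb 2 (1 + a * x) ∂expMeasure 1 = -(1 / Real.log 2) * expEi a := by
  rw [integral_expMeasure_one]
  simp only [Real.logb, div_mul_eq_mul_div]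
  rw [integral_div, integral_log_mul_exp_neg ha]
  ring

/-! ### Water-filling -/

section

/-- Unspent power would enlarge a factor, so the budget is exhausted. Moving power from an active
coordinate to one of lower level `c + s` would enlarge the product, so active coordinates all sit at
the minimal level, which is `1/ν`. -/
lemma waterFilling_of_isMaxOn_prod {ι : Type*} [Fintype ι] [Nonempty ι] {c s : ι → ℝ} {p : ℝ}
    (hp : 0 < p) (hc : ∀ m, 0 < c m) (hs : ∀ m, 0 ≤ s m) (hsum : ∑ m, s m ≤ p)
    (hmax : ∀ t : ι → ℝ, (∀ m, 0 ≤ t m) → ∑ m, t m ≤ p →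
      ∏ m, (c m + t m) ≤ ∏ m, (c m + s m)) :
    ∃ ν : ℝ, 0 < ν ∧ (∀ m, s m = max 0 (1 / ν - c m)) ∧ ∑ m, s m = p := by
  classical
  set g : ι → ℝ := fun m => c m + s m
  have hg : ∀ m, 0 < g m := fun m => add_pos_of_pos_of_nonneg (hc m) (hs m)
  have hupd : ∀ (t : ι → ℝ) i x, (fun m => c m + Function.update t i x m) =
      Function.update (fun m => c m + t m) i (c i + x) := fun t i x => by
    ext m
    by_cases h : m = i
    · subst h
      simp
    · simp [h]
  have hfull : ∑ m, s m = p := by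
    refine hsum.antisymm (not_lt.1 fun hlt => ?_)
    obtain ⟨i⟩ := ‹Nonempty ι›
    have h := hmax (Function.update s i (s i + (p - ∑ m, s m))) (fun m => ?_) ?_
    · have h1 : ∏ m, g m = g i * ∏ m ∈ Finset.univ \ {i}, g m := by
        conv_lhs => rw [← Function.update_eq_self i g]
        rw [Finset.prod_update_of_mem (Finset.mem_univ i)]
      have h2 : ∏ m, (c m + Function.update s i (s i + (p - ∑ m, s m)) m) =
          (c i + (s i + (p - ∑ m, s m))) * ∏ m ∈ Finset.univ \ {i}, g m := by
        rw [← Finset.prod_update_of_mem (Finset.mem_univ i), ← hupd]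
      rw [h2, h1] at h
      have h3 : 0 < ∏ m ∈ Finset.univ \ {i}, g m := Finset.prod_pos fun m _ => hg m
      have h4 := le_of_mul_le_mul_right h h3
      simp only [g] at h4
      linarith
    · by_cases hm : m = i
      · subst hm
        simp only [Function.update_self]
        linarith [hs m]
      · simpa [hm] using hs m
    · have h1 : ∑ m, s m = s i + ∑ m ∈ Finset.univ \ {i}, s m := by
        conv_lhs => rw [← Function.update_eq_self i s]
        rw [Finset.sum_update_of_mem (Finset.mem_univ i)]
      rw [Finset.sum_update_of_mem (Finset.mem_univ i)]
      linarith
  have hkey : ∀ i j, 0 < s i → g i ≤ g j := fun i j hi => by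
    by_contra! hlt
    have hij : i ≠ j := by
      rintro rfl
      exact lt_irrefl _ hlt
    -- `ε < s i` keeps the powers nonnegative; `ε < g i - g j` makes `(g i - ε)(g j + ε) - g i g j =
    -- ε (g i - g j - ε)` positive.
    obtain ⟨ε, hε0, hε⟩ := exists_between (lt_min hi (sub_pos.2 hlt))
    have hε1 := hε.trans_le (min_le_left _ _)
    have hε2 := hε.trans_le (min_le_right _ _)
    have hmem : i ∈ Finset.univ \ {j} := by simp [hij]
    have hprod : ∀ a b, ∏ m, Function.update (Function.update g i a) j b m =
        b * (a * ∏ m ∈ (Finset.univ \ {j}) \ {i}, g m) := fun a b => by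
      rw [Finset.prod_update_of_mem (Finset.mem_univ j), Finset.prod_update_of_mem hmem]
    have hsum2 : ∀ a b, ∑ m, Function.update (Function.update s i a) j b m =
        b + (a + ∑ m ∈ (Finset.univ \ {j}) \ {i}, s m) := fun a b => by
      rw [Finset.sum_update_of_mem (Finset.mem_univ j), Finset.sum_update_of_mem hmem]
    have h := hmax (Function.update (Function.update s i (s i - ε)) j (s j + ε)) (fun m => ?_) ?_
    · have h2 := hprod (g i) (g j)
      rw [Function.update_eq_self, Function.update_eq_self] at h2
      rw [hupd, hupd, hprod, h2, ← mul_assoc, ← mul_assoc] at h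
      have h3 : 0 < ∏ m ∈ (Finset.univ \ {j}) \ {i}, g m := Finset.prod_pos fun m _ => hg m
      have h4 := le_of_mul_le_mul_right h h3
      simp only [g] at h4 hε2
      nlinarith
    · by_cases hm : m = j
      · subst hm
        simp only [Function.update_self]
        linarith [hs m]
      · by_cases hm' : m = i
        · subst hm'
          simp only [Function.update_of_ne hm, Function.update_self]
          linarith
        · simpa [hm, hm'] using hs m
    · have h2 := hsum2 (s i) (s j)
      rw [Function.update_eq_self, Function.update_eq_self] at h2
      rw [hsum2]
      linarith
  obtain ⟨i, -, hi⟩ := Finset.exists_lt_of_sum_lt (s := Finset.univ) (f := fun _ : ι => (0 : ℝ))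
    (g := s) (by simpa [hfull] using hp)
  refine ⟨1 / g i, one_div_pos.2 (hg i), fun m => ?_, hfull⟩
  rw [one_div_one_div]
  have h1 := hkey i m hi
  rcases (hs m).eq_or_lt with h0 | hpos
  · simp only [g, ← h0] at h1 ⊢
    rw [max_eq_left (by linarith)]
  · have h2 := hkey m i hpos
    have h3 : g i = g m := le_antisymm h1 h2
    rw [h3, max_eq_right] <;> simp only [g] <;> linarith

variable {M : ℕ}

lemma trace_precoder_mul_conjTranspose {U : Matrix (Fin M) (Fin M) ℂ}
    (hU : U ∈ Matrix.unitaryGroup (Fin M) ℂ) {t : Fin M → ℝ} (ht : ∀ m, 0 ≤ t m) :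
    (Matrix.trace (precoder U t * (precoder U t)ᴴ)).re = ∑ m, t m := by
  have h2 : Uᴴ * U = 1 := (Matrix.mem_unitaryGroup_iff').1 hU
  rw [Matrix.trace_mul_comm, precoder, Matrix.conjTranspose_mul, mul_assoc, ← mul_assoc Uᴴ, h2,
    one_mul, Matrix.diagonal_conjTranspose, Matrix.diagonal_mul_diagonal, Matrix.trace_diagonal,
    Complex.re_sum]
  refine Finset.sum_congr rfl fun m _ => ?_
  simp [Real.mul_self_sqrt (ht m)]

lemma sensingObjective_precoder {U : Matrix (Fin M) (Fin M) ℂ}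
    (hU : U ∈ Matrix.unitaryGroup (Fin M) ℂ) (lam : Fin M → ℝ) (L : ℕ) {t : Fin M → ℝ}
    (ht : ∀ m, 0 ≤ t m) :
    sensingObjective (U * Matrix.diagonal (fun m => (lam m : ℂ)) * Uᴴ) L (precoder U t) =
      Real.logb 2 (∏ m, (1 + L * lam m * t m)) := by
  have h2 : Uᴴ * U = 1 := (Matrix.mem_unitaryGroup_iff').1 hU
  set D : Matrix (Fin M) (Fin M) ℂ := Matrix.diagonal fun m => ((Real.sqrt (t m) : ℝ) : ℂ) with hD
  set Λ := Matrix.diagonal (fun m => (lam m : ℂ)) with hΛ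
  have h3 : (U * D)ᴴ * (U * Λ * Uᴴ) * (U * D) = Dᴴ * Λ * D := by
    calc (U * D)ᴴ * (U * Λ * Uᴴ) * (U * D) = Dᴴ * (Uᴴ * U) * Λ * (Uᴴ * U) * D := by
          rw [Matrix.conjTranspose_mul]
          simp only [mul_assoc]
      _ = Dᴴ * Λ * D := by rw [h2, mul_one, mul_one]
  have h4 : 1 + (L : ℂ) • (Dᴴ * Λ * D) =
      Matrix.diagonal fun m => ((1 + L * lam m * t m : ℝ) : ℂ) := by
    rw [hD, hΛ, Matrix.diagonal_conjTranspose, Matrix.diagonal_mul_diagonal,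
      Matrix.diagonal_mul_diagonal, ← Matrix.diagonal_smul, ← Matrix.diagonal_one,
      Matrix.diagonal_add]
    congr 1
    ext m
    have h5 : ((Real.sqrt (t m) : ℝ) : ℂ) * ((Real.sqrt (t m) : ℝ) : ℂ) = (t m : ℂ) := by
      exact_mod_cast Real.mul_self_sqrt (ht m)
    simp only [Pi.smul_apply, Pi.star_apply, RCLike.star_def, Complex.conj_ofReal, smul_eq_mul]
    push_cast
    rw [← h5]
    ring
  rw [sensingObjective, precoder, h3, h4, Matrix.det_diagonal, ← Complex.ofReal_prod,
    Complex.ofReal_re]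

lemma IsSCDesign.lam_pos {R : Matrix (Fin M) (Fin M) ℂ} (hR : R.PosDef) {L : ℕ} {p : ℝ}
    {U : Matrix (Fin M) (Fin M) ℂ} {lam s : Fin M → ℝ} (h : IsSCDesign R L p U lam s) (m : Fin M) :
    0 < lam m := by
  have hU : IsUnit U := ⟨⟨U, star U, h.unitary.2, h.unitary.1⟩, rfl⟩
  have h1 := hR
  rw [h.eigen, ← Matrix.star_eq_conjTranspose, Matrix.IsUnit.posDef_star_right_conjugate_iff hU,
    Matrix.posDef_diagonal_iff] at h1
  exact_mod_cast h1 m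

lemma IsSCDesign.waterFilling {R : Matrix (Fin M) (Fin M) ℂ} (hM : 1 ≤ M) (hR : R.PosDef) {L : ℕ}
    (hL : 1 ≤ L) {p : ℝ} (hp : 0 < p) {U : Matrix (Fin M) (Fin M) ℂ} {lam s : Fin M → ℝ}
    (h : IsSCDesign R L p U lam s) :
    ∃ ν : ℝ, 0 < ν ∧ (∀ m, s m = max 0 (1 / ν - 1 / (L * lam m))) ∧
      ∑ m, max 0 (1 / ν - 1 / (L * lam m)) = p := by
  have : Nonempty (Fin M) := ⟨⟨0, hM⟩⟩
  have hL' : (0 : ℝ) < L := by exact_mod_cast hL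
  have hlam := h.lam_pos hR
  have hLl : ∀ m, 0 < L * lam m := fun m => mul_pos hL' (hlam m)
  have hsum : ∑ m, s m ≤ p := by
    rw [← trace_precoder_mul_conjTranspose h.unitary h.nonneg]
    exact h.feasible
  -- Extracting `L λ_m` from each factor leaves the product with offsets `c m = 1/(L λ_m)`.
  have hfac : ∀ t : Fin M → ℝ, ∏ m, (1 + L * lam m * t m) =
      (∏ m, (L * lam m)) * ∏ m, (1 / (L * lam m) + t m) := fun t => by
    rw [← Finset.prod_mul_distrib]
    refine Finset.prod_congr rfl fun m _ => ?_
    rw [mul_add, mul_one_div_cancel (hLl m).ne']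
  obtain ⟨ν, hν, hs, hp'⟩ := waterFilling_of_isMaxOn_prod (c := fun m => 1 / (L * lam m)) hp
    (fun m => one_div_pos.2 (hLl m)) h.nonneg hsum fun t ht htp => by
      have h1 := h.optimal (a := precoder U t) (by
        simpa only [feasiblePrecoders, Set.mem_ofPred_eq,
          trace_precoder_mul_conjTranspose h.unitary ht] using htp)
      have h2 : sensingObjective R L (precoder U t) ≤ sensingObjective R L (precoder U s) := h1
      have hpos : ∀ t : Fin M → ℝ, (∀ m, 0 ≤ t m) → 0 < ∏ m, (1 + L * lam m * t m) :=
        fun t ht => Finset.prod_pos fun m _ => by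
          have := mul_nonneg (hLl m).le (ht m)
          linarith
      rw [h.eigen, sensingObjective_precoder h.unitary _ _ ht,
        sensingObjective_precoder h.unitary _ _ h.nonneg,
        Real.logb_le_logb one_lt_two (hpos t ht) (hpos s h.nonneg), hfac, hfac] at h2
      exact le_of_mul_le_mul_left h2 (Finset.prod_pos fun m _ => hLl m)
  refine ⟨ν, hν, hs, ?_⟩
  rw [← hp']
  exact Finset.sum_congr rfl fun m _ => (hs m).symm

end

/-! ### Rates as functions of `1/‖v‖²`, and their bounds -/

section

variable {N M : ℕ}

lemma sum_norm_sq_col_unitary {U : Matrix (Fin M) (Fin M) ℂ}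
    (hU : U ∈ Matrix.unitaryGroup (Fin M) ℂ) (m : Fin M) : ∑ i, ‖U i m‖ ^ 2 = 1 := by
  have h2 : Uᴴ * U = 1 := (Matrix.mem_unitaryGroup_iff').1 hU
  have h3 := congrFun (congrFun h2 m) m
  have h4 := dotProduct_star_self_eq_sum fun i => U i m
  rw [Matrix.one_apply_eq, Matrix.mul_apply] at h3
  have h5 : star (fun i => U i m) ⬝ᵥ (fun i => U i m) = 1 := h3
  rw [h5] at h4
  exact_mod_cast h4.symm

/-- `vᴴ H u = (Hᴴ v)ᴴ u = uᴴ u`. -/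
lemma gain_eq_one {H : Matrix (Fin N) (Fin M) ℂ} {u : Fin M → ℂ} (hu : ∑ i, ‖u i‖ ^ 2 = 1)
    {v : EuclideanSpace ℂ (Fin N)} (hv : Hᴴ *ᵥ v.ofLp = u) : gain H u v = 1 := by
  have h1 : star v.ofLp ⬝ᵥ (H *ᵥ u) = star u ⬝ᵥ u := by
    conv_rhs => rw [← hv]
    rw [Matrix.star_mulVec, Matrix.conjTranspose_conjTranspose, ← Matrix.dotProduct_mulVec, hv]
  rw [gain, h1, dotProduct_star_self_eq_sum, hu]
  simp

lemma one_le_largestEig_mul_norm_sq {H : Matrix (Fin N) (Fin M) ℂ} {u : Fin M → ℂ}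
    (hu : ∑ i, ‖u i‖ ^ 2 = 1) {v : EuclideanSpace ℂ (Fin N)} (hv : Hᴴ *ᵥ v.ofLp = u) :
    1 ≤ largestEig H * ‖v‖ ^ 2 := by
  have h := sum_norm_sq_conjTranspose_mulVec_le H v.ofLp
  rwa [hv, hu, ← EuclideanSpace.norm_sq_eq] at h

lemma norm_sq_pos_of_detector {H : Matrix (Fin N) (Fin M) ℂ} {u : Fin M → ℂ}
    (hu : ∑ i, ‖u i‖ ^ 2 = 1) {v : EuclideanSpace ℂ (Fin N)} (hv : Hᴴ *ᵥ v.ofLp = u) :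
    0 < ‖v‖ ^ 2 := by
  refine (sq_nonneg ‖v‖).lt_of_ne' fun h0 => ?_
  have h := one_le_largestEig_mul_norm_sq hu hv
  rw [h0, mul_zero] at h
  exact absurd h (by norm_num)

lemma one_div_largestEig_le_norm_sq {H : Matrix (Fin N) (Fin M) ℂ} {u : Fin M → ℂ}
    (hu : ∑ i, ‖u i‖ ^ 2 = 1) {v : EuclideanSpace ℂ (Fin N)} (hv : Hᴴ *ᵥ v.ofLp = u) :
    1 / largestEig H ≤ ‖v‖ ^ 2 :=
  div_le_of_le_mul₀ (largestEig_nonneg H) (sq_nonneg _)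
    (by simpa only [mul_comm] using one_le_largestEig_mul_norm_sq hu hv)

lemma one_div_norm_sq_le_largestEig {H : Matrix (Fin N) (Fin M) ℂ} {u : Fin M → ℂ}
    (hu : ∑ i, ‖u i‖ ^ 2 = 1) {v : EuclideanSpace ℂ (Fin N)} (hv : Hᴴ *ᵥ v.ofLp = u) :
    1 / ‖v‖ ^ 2 ≤ largestEig H :=
  div_le_of_le_mul₀ (sq_nonneg _) (largestEig_nonneg H) (one_le_largestEig_mul_norm_sq hu hv)

lemma snrNear_eq {H : Matrix (Fin N) (Fin M) ℂ} {u : Fin M → ℂ} (hu : ∑ i, ‖u i‖ ^ 2 = 1)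
    {v : EuclideanSpace ℂ (Fin N)} (hv : Hᴴ *ᵥ v.ofLp = u) (α η q : ℝ) :
    snrNear α η q H u v = α * η⁻¹ * q * (1 / ‖v‖ ^ 2) := by
  rw [snrNear, gain_eq_one hu hv]
  ring

lemma sinrFar_eq {H : Matrix (Fin N) (Fin M) ℂ} {u : Fin M → ℂ} (hu : ∑ i, ‖u i‖ ^ 2 = 1)
    {v : EuclideanSpace ℂ (Fin N)} (hv : Hᴴ *ᵥ v.ofLp = u) (α α' η' q : ℝ) :
    sinrFar α α' η' q H u v =
      α' * η'⁻¹ * q * (1 / ‖v‖ ^ 2) / (α * η'⁻¹ * q * (1 / ‖v‖ ^ 2) + 1) := by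
  have h := (norm_sq_pos_of_detector hu hv).ne'
  rw [sinrFar, gain_eq_one hu hv, mul_one, mul_one, mul_one_div, mul_one_div,
    div_add_one h, div_div_div_cancel_right₀ h]

/-- Rates `φ (x)` that are monotone and at most linear in the received power `x ≥ 0`. -/
structure IsRateFunction (φ : ℝ → ℝ) : Prop where
  measurable : Measurable φ
  nonneg : ∀ x, 0 ≤ x → 0 ≤ φ x
  mono : ∀ x y, 0 ≤ x → x ≤ y → φ x ≤ φ y
  le_linear : ∃ C, ∀ x, 0 ≤ x → φ x ≤ C * x

lemma IsRateFunction.map_zero {φ : ℝ → ℝ} (h : IsRateFunction φ) : φ 0 = 0 := by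
  obtain ⟨C, hC⟩ := h.le_linear
  exact le_antisymm (by simpa using hC 0 le_rfl) (h.nonneg 0 le_rfl)

/-- Monotonicity reduces to `b x ≤ b y` once the denominators are cleared, as the terms `b c x y`
cancel. Linear growth is `log (1 + z) ≤ z`. The case `c = 0` is the near terminal. -/
lemma isRateFunction_far {b c : ℝ} (hb : 0 ≤ b) (hc : 0 ≤ c) :
    IsRateFunction fun x => Real.logb 2 (1 + b * x / (c * x + 1)) where
  measurable := by
    unfold Real.logb
    fun_prop
  nonneg x hx := Real.logb_nonneg one_lt_two (by
    have : 0 ≤ b * x / (c * x + 1) := by positivity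
    linarith)
  mono x y hx hxy := by
    have hy := hx.trans hxy
    refine Real.logb_le_logb_of_le one_lt_two (by positivity) ?_
    gcongr 1 + ?_
    rw [div_le_div_iff₀ (by positivity) (by positivity)]
    nlinarith [mul_le_mul_of_nonneg_left hxy hb]
  le_linear := by
    refine ⟨b / Real.log 2, fun x hx => ?_⟩
    have h0 : 0 ≤ b * x / (c * x + 1) := by positivity
    have h1 : b * x / (c * x + 1) ≤ b * x := div_le_self (by positivity) (by
      have := mul_nonneg hc hx
      linarith)
    have h2 := Real.log_le_sub_one_of_pos (show 0 < 1 + b * x / (c * x + 1) by linarith)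
    have h3 := Real.log_pos one_lt_two
    rw [Real.logb, div_mul_eq_mul_div]
    gcongr
    linarith

lemma isRateFunction_near {a : ℝ} (ha : 0 ≤ a) :
    IsRateFunction fun x => Real.logb 2 (1 + a * x) := by
  simpa using isRateFunction_far ha le_rfl

lemma integrable_norm_sq_stdComplexGaussian :
    Integrable (fun z : ℂ => ‖z‖ ^ 2) stdComplexGaussian := by
  have h : Integrable (fun x : ℝ => x ^ 2) (gaussianReal 0 (1 / 2)) :=
    (memLp_id_gaussianReal (μ := 0) (v := 1 / 2) 2).integrable_sq
  rw [stdComplexGaussian, integrable_map_equiv]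
  refine ((h.comp_fst (gaussianReal 0 (1 / 2))).add
    (h.comp_snd (gaussianReal 0 (1 / 2)))).congr (Filter.Eventually.of_forall fun p => ?_)
  simp only [Function.comp_apply, ← Complex.normSq_eq_norm_sq, Complex.normSq_apply]
  simp [sq]

lemma integrable_wishartMaxEig (N M : ℕ) :
    Integrable (wishartMaxEig N M) (gaussianMatrixLaw N M) := by
  have h : Integrable (fun h : Fin N × Fin M → ℂ => ∑ k, ‖h k‖ ^ 2) (gaussianMatrixLaw N M) :=
    integrable_finsetSum _ fun k _ =>
      (measurePreserving_eval (fun _ : Fin N × Fin M => stdComplexGaussian) k).integrable_comp_of_integrable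
        integrable_norm_sq_stdComplexGaussian
  refine h.mono' (measurable_wishartMaxEig N M).aestronglyMeasurable
    (Filter.Eventually.of_forall fun h => ?_)
  have h0 : 0 ≤ wishartMaxEig N M h := largestEig_nonneg _
  rw [Real.norm_of_nonneg h0]
  exact largestEig_le_sum _

lemma IsRateFunction.integrable_wishartMaxEig {φ : ℝ → ℝ} (h : IsRateFunction φ) (N M : ℕ) :
    Integrable (fun b => φ (wishartMaxEig N M b)) (gaussianMatrixLaw N M) := by
  obtain ⟨C, hC⟩ := h.le_linear
  refine ((NomaIsac.integrable_wishartMaxEig N M).const_mul C).mono'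
    (h.measurable.comp (measurable_wishartMaxEig N M)).aestronglyMeasurable
    (Filter.Eventually.of_forall fun b => ?_)
  have h0 : 0 ≤ wishartMaxEig N M b := largestEig_nonneg _
  rw [Real.norm_of_nonneg (h.nonneg _ h0)]
  exact hC _ h0

/-- The eigenvalue is nonnegative and `φ 0 = 0`, so truncation to the open half-line loses nothing.
This reconciles integrals over `Set.Ioi 0` with the density on the whole line. -/
lemma IsRateFunction.indicator_wishartMaxEig {φ : ℝ → ℝ} (h : IsRateFunction φ) (N M : ℕ)
    (b : Fin N × Fin M → ℂ) :
    (Set.Ioi 0).indicator φ (wishartMaxEig N M b) = φ (wishartMaxEig N M b) := by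
  have h0 : 0 ≤ wishartMaxEig N M b := largestEig_nonneg _
  rcases h0.eq_or_lt with h1 | h1
  · rw [← h1, h.map_zero]
    simp
  · exact Set.indicator_of_mem h1 φ

lemma indicator_mul_pdf (φ : ℝ → ℝ) (N M : ℕ) :
    (Set.Ioi 0).indicator (fun x => φ x * wishartMaxEigPDF N M x) =
      fun x => (pdf (wishartMaxEig N M) (gaussianMatrixLaw N M) volume x).toReal •
        (Set.Ioi 0).indicator φ x := by
  ext x
  by_cases hx : x ∈ Set.Ioi (0 : ℝ) <;> simp [hx, wishartMaxEigPDF, mul_comm]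

lemma IsRateFunction.integrableOn_mul_pdf {φ : ℝ → ℝ} (h : IsRateFunction φ) (hN : 1 ≤ N)
    (hM : 1 ≤ M) : IntegrableOn (fun x => φ x * wishartMaxEigPDF N M x) (Set.Ioi 0) := by
  have := hasPDF_wishartMaxEig hN hM
  rw [← integrable_indicator_iff measurableSet_Ioi, indicator_mul_pdf,
    pdf.integrable_pdf_smul_iff (h.measurable.indicator measurableSet_Ioi).aestronglyMeasurable]
  simpa only [h.indicator_wishartMaxEig] using h.integrable_wishartMaxEig N M

lemma IsRateFunction.setIntegral_mul_pdf {φ : ℝ → ℝ} (h : IsRateFunction φ) (hN : 1 ≤ N)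
    (hM : 1 ≤ M) : ∫ x in Set.Ioi 0, φ x * wishartMaxEigPDF N M x =
      ∫ b, φ (wishartMaxEig N M b) ∂gaussianMatrixLaw N M := by
  have := hasPDF_wishartMaxEig hN hM
  rw [← integral_indicator measurableSet_Ioi, indicator_mul_pdf,
    pdf.integral_pdf_smul (h.measurable.indicator measurableSet_Ioi).aestronglyMeasurable]
  simp only [h.indicator_wishartMaxEig]

section Rates

variable {Ω : Type*} [MeasurableSpace Ω] {P : Measure Ω} {H : Ω → Matrix (Fin N) (Fin M) ℂ}
  {u : Fin M → ℂ} {v : Ω → EuclideanSpace ℂ (Fin N)}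

lemma IsRayleighChannel.integrable_rate_largestEig (hH : IsRayleighChannel H P) {φ : ℝ → ℝ}
    (h : IsRateFunction φ) : Integrable (fun ω => φ (largestEig (H ω))) P := by
  have hl := hH.hasLaw_entries
  have h1 := h.integrable_wishartMaxEig N M
  rw [← hl.map_eq] at h1
  exact h1.comp_aemeasurable hl.aemeasurable

lemma IsRayleighChannel.integral_rate_largestEig (hH : IsRayleighChannel H P) {φ : ℝ → ℝ}
    (h : IsRateFunction φ) (hN : 1 ≤ N) (hM : 1 ≤ M) : ∫ ω, φ (largestEig (H ω)) ∂P =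
      ∫ x in Set.Ioi 0, φ x * wishartMaxEigPDF N M x := by
  rw [h.setIntegral_mul_pdf hN hM]
  exact hH.hasLaw_entries.integral_comp
    (h.measurable.comp (measurable_wishartMaxEig N M)).aestronglyMeasurable

lemma IsDetector.integrable_rate (hH : IsRayleighChannel H P) (hu : ∑ i, ‖u i‖ ^ 2 = 1)
    (hv : IsDetector P H u v) {φ : ℝ → ℝ} (h : IsRateFunction φ) :
    Integrable (fun ω => φ (1 / ‖v ω‖ ^ 2)) P := by
  refine (hH.integrable_rate_largestEig h).mono'
    (h.measurable.comp_aemeasurable ?_).aestronglyMeasurable ?_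
  · exact (hv.1.norm.pow_const 2).const_div 1
  · filter_upwards [hv.2] with ω hω
    have h0 : 0 ≤ 1 / ‖v ω‖ ^ 2 := by positivity
    rw [Real.norm_of_nonneg (h.nonneg _ h0)]
    exact h.mono _ _ h0 (one_div_norm_sq_le_largestEig hu hω)

lemma IsDetector.integral_rate_le (hH : IsRayleighChannel H P) (hu : ∑ i, ‖u i‖ ^ 2 = 1)
    (hv : IsDetector P H u v) {φ : ℝ → ℝ} (h : IsRateFunction φ) (hN : 1 ≤ N) (hM : 1 ≤ M) :
    ∫ ω, φ (1 / ‖v ω‖ ^ 2) ∂P ≤ ∫ x in Set.Ioi 0, φ x * wishartMaxEigPDF N M x := by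
  rw [← hH.integral_rate_largestEig h hN hM]
  refine integral_mono_ae (hv.integrable_rate hH hu h) (hH.integrable_rate_largestEig h) ?_
  filter_upwards [hv.2] with ω hω
  exact h.mono _ _ (by positivity) (one_div_norm_sq_le_largestEig hu hω)

lemma IsDetector.rate_near_ae_eq (hu : ∑ i, ‖u i‖ ^ 2 = 1) (hv : IsDetector P H u v)
    (α η q : ℝ) : (fun ω => Real.logb 2 (1 + snrNear α η q (H ω) u (v ω))) =ᵐ[P]
      fun ω => Real.logb 2 (1 + α * η⁻¹ * q * (1 / ‖v ω‖ ^ 2)) := by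
  filter_upwards [hv.2] with ω hω
  rw [snrNear_eq hu hω]

lemma IsDetector.rate_far_ae_eq (hu : ∑ i, ‖u i‖ ^ 2 = 1) (hv : IsDetector P H u v)
    (α α' η' q : ℝ) : (fun ω => Real.logb 2 (1 + sinrFar α α' η' q (H ω) u (v ω))) =ᵐ[P]
      fun ω => Real.logb 2 (1 + α' * η'⁻¹ * q * (1 / ‖v ω‖ ^ 2) /
        (α * η'⁻¹ * q * (1 / ‖v ω‖ ^ 2) + 1)) := by
  filter_upwards [hv.2] with ω hω
  rw [sinrFar_eq hu hω]

end Rates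

lemma integral_logb_far_expMeasure_one {b c : ℝ} (hb : 0 ≤ b) (hc : 0 ≤ c) :
    ∫ x, Real.logb 2 (1 + b * x / (c * x + 1)) ∂expMeasure 1 =
      -(1 / Real.log 2) * expEi (b + c) + (1 / Real.log 2) * expEi c := by
  rw [integral_expMeasure_one]
  have h1 : ∫ x in Set.Ioi 0, Real.logb 2 (1 + b * x / (c * x + 1)) * Real.exp (-x) =
      ∫ x in Set.Ioi 0, (Real.log (1 + (b + c) * x) * Real.exp (-x) -
        Real.log (1 + c * x) * Real.exp (-x)) / Real.log 2 := by
    refine setIntegral_congr_fun measurableSet_Ioi fun x hx => ?_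
    have hx0 : (0 : ℝ) < x := hx
    -- The rate is a difference of two logarithms of the near-terminal type.
    have h2 : 1 + b * x / (c * x + 1) = (1 + (b + c) * x) / (1 + c * x) := by
      field_simp
      ring
    simp only [h2]
    rw [Real.logb, Real.log_div (by positivity) (by positivity)]
    ring
  rw [h1, integral_div, integral_sub (integrableOn_log_mul_exp_neg (add_nonneg hb hc))
    (integrableOn_log_mul_exp_neg hc), integral_log_mul_exp_neg (add_nonneg hb hc),
    integral_log_mul_exp_neg hc]
  ring

end

end NomaIsac

end

/-! ### Assembly of the theorem -/

theorem theorem2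
    {Ω : Type*} [MeasurableSpace Ω] (P : Measure Ω) [IsProbabilityMeasure P]
    (M N L : ℕ) (hM : 1 ≤ M) (hMN : M ≤ N) (hL : 1 ≤ L)
    (p : ℝ) (hp : 0 < p)
    -- target correlation matrix and sensing-centric design
    (R : Matrix (Fin M) (Fin M) ℂ) (hR : R.PosDef)
    (U : Matrix (Fin M) (Fin M) ℂ) (lam s : Fin M → ℝ)
    (hSC : NomaIsac.IsSCDesign R L p U lam s)
    -- NOMA power coefficients and path losses of the near / far terminals
    (α α' η η' : Fin M → ℝ)
    (hα : ∀ m, 0 < α m) (hα' : ∀ m, 0 < α' m) (hαα' : ∀ m, α m + α' m = 1)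
    (hη : ∀ m, 0 < η m) (hη' : ∀ m, 0 < η' m)
    -- channels and detection vectors of the near / far terminals
    (H H' : Fin M → Ω → Matrix (Fin N) (Fin M) ℂ)
    (hH : ∀ m, NomaIsac.IsRayleighChannel (H m) P)
    (hH' : ∀ m, NomaIsac.IsRayleighChannel (H' m) P)
    (v v' : Fin M → Ω → EuclideanSpace ℂ (Fin N))
    (hv : ∀ m, NomaIsac.IsDetector P (H m) (fun i => U i m) (v m))
    (hv' : ∀ m, NomaIsac.IsDetector P (H' m) (fun i => U i m) (v' m))
    -- SNR / SINR and ergodic rates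
    (γ γ' : Fin M → Ω → ℝ)
    (hγ : ∀ m ω, γ m ω =
      NomaIsac.snrNear (α m) (η m) (s m) (H m ω) (fun i => U i m) (v m ω))
    (hγ' : ∀ m ω, γ' m ω =
      NomaIsac.sinrFar (α m) (α' m) (η' m) (s m) (H' m ω) (fun i => U i m) (v' m ω)) :
    -- the powers are the water-filling powers
    (∃ ν : ℝ, 0 < ν ∧ (∀ m, s m = max 0 (1 / ν - 1 / (L * lam m))) ∧
      ∑ m, max 0 (1 / ν - 1 / (L * lam m)) = p) ∧
    -- the largest eigenvalue of the Wishart matrix has a density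
    HasPDF (NomaIsac.wishartMaxEig N M) (NomaIsac.gaussianMatrixLaw N M) volume ∧
    -- lower bounds for the squared norms of the detection vectors
    (∀ m, (∀ᵐ ω ∂P, 1 / NomaIsac.largestEig (H m ω) ≤ ‖v m ω‖ ^ 2) ∧
      (∀ᵐ ω ∂P, 1 / NomaIsac.largestEig (H' m ω) ≤ ‖v' m ω‖ ^ 2)) ∧
    -- all expectations and integrals exist
    (∀ m, Integrable (fun ω => Real.logb 2 (1 + γ m ω)) P ∧
      Integrable (fun ω => Real.logb 2 (1 + γ' m ω)) P ∧
      IntegrableOn (NomaIsac.nearIntegrand N M (α m) (η m) (s m)) (Set.Ioi 0) ∧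
      IntegrableOn (NomaIsac.farIntegrand N M (α m) (α' m) (η' m) (s m)) (Set.Ioi 0)) ∧
    -- upper bounds for the rates of the individual terminals
    (∀ m, NomaIsac.ergodicRate P (γ m) ≤
        ∫ x in Set.Ioi 0, NomaIsac.nearIntegrand N M (α m) (η m) (s m) x) ∧
    (∀ m, NomaIsac.ergodicRate P (γ' m) ≤
        ∫ x in Set.Ioi 0, NomaIsac.farIntegrand N M (α m) (α' m) (η' m) (s m) x) ∧
    -- upper bound for the sum rate
    (∑ m, (NomaIsac.ergodicRate P (γ m) + NomaIsac.ergodicRate P (γ' m)) ≤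
      ∑ m, ((∫ x in Set.Ioi 0, NomaIsac.nearIntegrand N M (α m) (η m) (s m) x) +
        ∫ x in Set.Ioi 0, NomaIsac.farIntegrand N M (α m) (α' m) (η' m) (s m) x)) ∧
    -- exact rates for equal numbers of antennas
    (N = M →
      (∀ m, HasLaw (fun ω => 1 / ‖v m ω‖ ^ 2) (expMeasure 1) P ∧
        HasLaw (fun ω => 1 / ‖v' m ω‖ ^ 2) (expMeasure 1) P) ∧
      (∀ m, NomaIsac.ergodicRate P (γ m) =
        -(1 / Real.log 2) * NomaIsac.expEi (α m * (η m)⁻¹ * s m)) ∧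
      (∀ m, NomaIsac.ergodicRate P (γ' m) =
        -(1 / Real.log 2) * NomaIsac.expEi ((η' m)⁻¹ * s m) +
          (1 / Real.log 2) * NomaIsac.expEi (α m * (η' m)⁻¹ * s m)) ∧
      ∑ m, (NomaIsac.ergodicRate P (γ m) + NomaIsac.ergodicRate P (γ' m)) =
        ∑ m, (-(1 / Real.log 2) * NomaIsac.expEi (α m * (η m)⁻¹ * s m) +
          (-(1 / Real.log 2) * NomaIsac.expEi ((η' m)⁻¹ * s m) +
            (1 / Real.log 2) * NomaIsac.expEi (α m * (η' m)⁻¹ * s m)))) := by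
  have hN : 1 ≤ N := hM.trans hMN
  have hU := hSC.unitary
  have hu := fun m => NomaIsac.sum_norm_sq_col_unitary hU m
  have hs := hSC.nonneg
  have ha : ∀ m, 0 ≤ α m * (η m)⁻¹ * s m := fun m =>
    mul_nonneg (mul_nonneg (hα m).le (inv_nonneg.2 (hη m).le)) (hs m)
  have hb : ∀ m, 0 ≤ α' m * (η' m)⁻¹ * s m := fun m =>
    mul_nonneg (mul_nonneg (hα' m).le (inv_nonneg.2 (hη' m).le)) (hs m)
  have hc : ∀ m, 0 ≤ α m * (η' m)⁻¹ * s m := fun m =>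
    mul_nonneg (mul_nonneg (hα m).le (inv_nonneg.2 (hη' m).le)) (hs m)
  have hφ := fun m => NomaIsac.isRateFunction_near (ha m)
  have hφ' := fun m => NomaIsac.isRateFunction_far (hb m) (hc m)
  have hrate := fun m => (hv m).rate_near_ae_eq (hu m) (α m) (η m) (s m)
  have hrate' := fun m => (hv' m).rate_far_ae_eq (hu m) (α m) (α' m) (η' m) (s m)
  simp only [← hγ] at hrate
  simp only [← hγ'] at hrate'
  have hle : ∀ m, NomaIsac.ergodicRate P (γ m) ≤
      ∫ x in Set.Ioi 0, NomaIsac.nearIntegrand N M (α m) (η m) (s m) x := fun m => by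
    rw [NomaIsac.ergodicRate, integral_congr_ae (hrate m)]
    exact (hv m).integral_rate_le (hH m) (hu m) (hφ m) hN hM
  have hle' : ∀ m, NomaIsac.ergodicRate P (γ' m) ≤
      ∫ x in Set.Ioi 0, NomaIsac.farIntegrand N M (α m) (α' m) (η' m) (s m) x := fun m => by
    rw [NomaIsac.ergodicRate, integral_congr_ae (hrate' m)]
    exact (hv' m).integral_rate_le (hH' m) (hu m) (hφ' m) hN hM
  refine ⟨hSC.waterFilling hM hR hL hp, NomaIsac.hasPDF_wishartMaxEig hN hM, fun m => ⟨?_, ?_⟩,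
    fun m => ⟨?_, ?_, ?_, ?_⟩, hle, hle',
    Finset.sum_le_sum fun m _ => add_le_add (hle m) (hle' m), fun hNM => ?_⟩
  · exact (hv m).2.mono fun ω hω => NomaIsac.one_div_largestEig_le_norm_sq (hu m) hω
  · exact (hv' m).2.mono fun ω hω => NomaIsac.one_div_largestEig_le_norm_sq (hu m) hω
  · exact ((hv m).integrable_rate (hH m) (hu m) (hφ m)).congr (hrate m).symm
  · exact ((hv' m).integrable_rate (hH' m) (hu m) (hφ' m)).congr (hrate' m).symm
  · exact (hφ m).integrableOn_mul_pdf hN hM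
  · exact (hφ' m).integrableOn_mul_pdf hN hM
  · subst hNM
    have hlaw := fun m => NomaIsac.IsDetector.hasLaw_one_div_norm_sq (hH m) hU m (hv m)
    have hlaw' := fun m => NomaIsac.IsDetector.hasLaw_one_div_norm_sq (hH' m) hU m (hv' m)
    have heq : ∀ m, NomaIsac.ergodicRate P (γ m) =
        -(1 / Real.log 2) * NomaIsac.expEi (α m * (η m)⁻¹ * s m) := fun m => by
      rw [NomaIsac.ergodicRate, integral_congr_ae (hrate m),
        ← NomaIsac.integral_logb_expMeasure_one (ha m)]
      exact (hlaw m).integral_comp (hφ m).measurable.aestronglyMeasurable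
    have heq' : ∀ m, NomaIsac.ergodicRate P (γ' m) =
        -(1 / Real.log 2) * NomaIsac.expEi ((η' m)⁻¹ * s m) +
          (1 / Real.log 2) * NomaIsac.expEi (α m * (η' m)⁻¹ * s m) := fun m => by
      -- Signal and interference coefficients add up to the full stream power because `α + α' = 1`.
      have hbc : (η' m)⁻¹ * s m = α' m * (η' m)⁻¹ * s m + α m * (η' m)⁻¹ * s m := by
        rw [← add_mul, ← add_mul, add_comm (α' m), hαα' m, one_mul]
      rw [NomaIsac.ergodicRate, integral_congr_ae (hrate' m), hbc,
        ← NomaIsac.integral_logb_far_expMeasure_one (hb m) (hc m)]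
      exact (hlaw' m).integral_comp (hφ' m).measurable.aestronglyMeasurable
    exact ⟨fun m => ⟨hlaw m, hlaw' m⟩, heq, heq',
      Finset.sum_congr rfl fun m _ => by rw [heq m, heq' m]⟩
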